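/- Let $K$ be a commutative ring; all algebras are unital associative $K$-algebras. Let $T=(T,R,\tilde s,\tilde t,\Delta_T,\varepsilon_T)$ be a right bialgebroid over a $K$-algebra $R$, that is: $\tilde s:R\to T$ is an algebra homomorphism and $\tilde t:R\to T$ an algebra anti-homomorphism with commuting images; $T$ is an $R$-$R$-bimodule by $r\cdot x\cdot r'=x\,\tilde s(r')\,\tilde t(r)$ and an $R$-coring via $\Delta_T:T\to T\otimes_R T$, $\varepsilon_T:T\to R$; and $\Delta_T(1)=1\otimes 1$, $\varepsilon_T(1)=1$, $\varepsilon_T(xy)=\varepsilon_T(\tilde t(\varepsilon_T(x))y)=\varepsilon_T(\tilde s(\varepsilon_T(x))y)$, $\tilde s(r)x_{(1)}\otimes x_{(2)}=x_{(1)}\otimes\tilde t(r)x_{(2)}$, $\Delta_T(xy)=\Delta_T(x)\Delta_T(y)$. Assume that ${}_RT$ is finitely generated projective. Let $A$ be a right $T$-comodule algebra: an algebra with an algebra homomorphism $R\to A$ and a coaction $\delta:A\to A\otimes_R T$, $\delta(a)=a_{(0)}\otimes a_{(1)}$, making $A$ a right comodule over the $R$-coring $T$, with $\delta(1)=1\otimes1$,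 $ra_{(0)}\otimes a_{(1)}=a_{(0)}\otimes\tilde t(r)a_{(1)}$ and $\delta(aa')=\delta(a)\delta(a')$. Let $B=\{a\in A\mid\delta(a)=a\otimes 1_T\}$ be its subalgebra of coinvariants (so that $A|B$ is a right $T$-extension). The Galois map is $\beta:A\otimes_BA\to A\otimes_RT$, $\beta(a\otimes a')=aa'_{(0)}\otimes a'_{(1)}$; it is a homomorphism of $A$-$B$-bimodules, where $a'(a\otimes x)b=a'ab\otimes x$ on $A\otimes_R T$. Suppose that $\beta$ is a split monomorphism of $A$-$B$-bimodules. Then $A|B$ is a right $(A\otimes_BA)^B$-Galois extension. In detail: let $T'=(A\otimes_BA)^B$, with product $tt'=t'^1t^1\otimes t^2t'^2$ and unit $1\otimes 1$, and let $R'$ be the centralizer of $B$ in $A$. There are finitely many $u_j\in T'$ and $B$-$B$-bimodule endomorphisms $\gamma_j$ of $A$ with $a\otimes_B a'=\sum_j a\gamma_j(a')u_j$ for all $a,a'\in A$, such that 1. $T'$ is a right bialgebroid over $R'$ with source $r\mapsto 1\otimes r$, target $r\mapsto r\otimes1$, counit $t\mapsto t^1t^2$ and coproduct $\Delta(t)=\sum_j(t^1\otimes_B\gamma_j(t^2))\otimes_{R'}u_j$;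 2. $A$ is a right $T'$-comodule algebra with the inclusion $R'\to A$ and the coaction $a\mapsto\sum_j\gamma_j(a)\otimes_{R'}u_j$; 3. its subalgebra of coinvariants is $B$, and its Galois map $A\otimes_BA\to A\otimes_{R'}T'$ is bijective. -/

import Mathlib

open scoped TensorProduct
open MulOpposite

noncomputable section

/-! Balanced tensor products over a noncommutative `K`-algebra `R`.

A left `R`-module (with compatible `K`-module structure) is given by its structure map
`R →ₐ[K] Module.End K N`, a right `R`-module by `Rᵐᵒᵖ →ₐ[K] Module.End K M`. -/

section Balanced

variable {K R S M N P M' N' : Type*} [CommRing K] [Ring R] [Algebra K R] [Ring S] [Algebra K S]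
  [AddCommGroup M] [Module K M] [AddCommGroup N] [Module K N] [AddCommGroup P] [Module K P]
  [AddCommGroup M'] [Module K M'] [AddCommGroup N'] [Module K N']

/-- The submodule of `M ⊗[K] N` spanned by the elements `m r ⊗ n - m ⊗ r n`. -/
def balRel (ρ : Rᵐᵒᵖ →ₐ[K] Module.End K M) (l : R →ₐ[K] Module.End K N) :
    Submodule K (M ⊗[K] N) :=
  Submodule.span K {z | ∃ (r : R) (m : M) (n : N), z = ρ (op r) m ⊗ₜ[K] n - m ⊗ₜ[K] l r n}

/-- The tensor product `M ⊗_R N` of a right `R`-module `M` and a left `R`-module `N`. -/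
def BalTensor (ρ : Rᵐᵒᵖ →ₐ[K] Module.End K M) (l : R →ₐ[K] Module.End K N) : Type _ :=
  (M ⊗[K] N) ⧸ balRel ρ l

namespace BalTensor

instance (ρ : Rᵐᵒᵖ →ₐ[K] Module.End K M) (l : R →ₐ[K] Module.End K N) :
    AddCommGroup (BalTensor ρ l) :=
  inferInstanceAs (AddCommGroup ((M ⊗[K] N) ⧸ balRel ρ l))

instance (ρ : Rᵐᵒᵖ →ₐ[K] Module.End K M) (l : R →ₐ[K] Module.End K N) :
    Module K (BalTensor ρ l) :=
  inferInstanceAs (Module K ((M ⊗[K] N) ⧸ balRel ρ l))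

/-- The projection `M ⊗_K N → M ⊗_R N`. -/
def mk (ρ : Rᵐᵒᵖ →ₐ[K] Module.End K M) (l : R →ₐ[K] Module.End K N) :
    M ⊗[K] N →ₗ[K] BalTensor ρ l :=
  (balRel ρ l).mkQ

/-- The pure tensor `m ⊗_R n`. -/
def tmul (ρ : Rᵐᵒᵖ →ₐ[K] Module.End K M) (l : R →ₐ[K] Module.End K N) (m : M) (n : N) :
    BalTensor ρ l :=
  mk ρ l (m ⊗ₜ[K] n)

variable {ρ : Rᵐᵒᵖ →ₐ[K] Module.End K M} {l : R →ₐ[K] Module.End K N}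
  {ρ' : Rᵐᵒᵖ →ₐ[K] Module.End K M'} {l' : R →ₐ[K] Module.End K N'}

@[simp] theorem add_tmul (m m' : M) (n : N) :
    tmul ρ l (m + m') n = tmul ρ l m n + tmul ρ l m' n := by
  simp [tmul, TensorProduct.add_tmul]

@[simp] theorem tmul_add (m : M) (n n' : N) :
    tmul ρ l m (n + n') = tmul ρ l m n + tmul ρ l m n' := by
  simp [tmul, TensorProduct.tmul_add]

@[simp] theorem smul_tmul (k : K) (m : M) (n : N) :
    tmul ρ l (k • m) n = k • tmul ρ l m n := by
  rw [tmul, tmul, ← map_smul, TensorProduct.smul_tmul']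

@[simp] theorem tmul_smul (k : K) (m : M) (n : N) :
    tmul ρ l m (k • n) = k • tmul ρ l m n := by
  simp [tmul]

theorem mk_surjective : Function.Surjective (mk ρ l) :=
  Submodule.mkQ_surjective _

theorem tmul_act (r : R) (m : M) (n : N) :
    tmul ρ l (ρ (op r) m) n = tmul ρ l m (l r n) := by
  refine (Submodule.Quotient.eq (balRel ρ l)).2 ?_
  exact Submodule.subset_span ⟨r, m, n, rfl⟩

theorem hom_ext {f g : BalTensor ρ l →ₗ[K] P}
    (h : ∀ m n, f (tmul ρ l m n) = g (tmul ρ l m n)) : f = g := by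
  apply Submodule.linearMap_qext
  apply TensorProduct.ext'
  exact h

/-- A `K`-bilinear `R`-balanced map factors through `M ⊗_R N`. -/
def lift (f : M →ₗ[K] N →ₗ[K] P) (h : ∀ r m n, f (ρ (op r) m) n = f m (l r n)) :
    BalTensor ρ l →ₗ[K] P :=
  (balRel ρ l).liftQ (TensorProduct.lift f) <| by
    unfold balRel
    rw [Submodule.span_le]
    rintro _ ⟨r, m, n, rfl⟩
    simp [h]

@[simp] theorem lift_tmul (f : M →ₗ[K] N →ₗ[K] P)
    (h : ∀ r m n, f (ρ (op r) m) n = f m (l r n)) (m : M) (n : N) :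
    lift f h (tmul ρ l m n) = f m n := by
  exact TensorProduct.lift.tmul m n

/-- The `K`-bilinear map `(m, n) ↦ m ⊗_R n`. -/
def tmulHom (ρ : Rᵐᵒᵖ →ₐ[K] Module.End K M) (l : R →ₐ[K] Module.End K N) :
    M →ₗ[K] N →ₗ[K] BalTensor ρ l :=
  (TensorProduct.mk K M N).compr₂ (mk ρ l)

@[simp] theorem tmulHom_apply (m : M) (n : N) : tmulHom ρ l m n = tmul ρ l m n := rfl

theorem id_ract (ρ : Rᵐᵒᵖ →ₐ[K] Module.End K M) (r : R) (m : M) :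
    (LinearMap.id : M →ₗ[K] M) (ρ (op r) m) = ρ (op r) ((LinearMap.id : M →ₗ[K] M) m) := rfl

theorem id_lact (l : R →ₐ[K] Module.End K N) (r : R) (n : N) :
    (LinearMap.id : N →ₗ[K] N) (l r n) = l r ((LinearMap.id : N →ₗ[K] N) n) := rfl

/-- `f ⊗_R g` for a right `R`-linear `f` and a left `R`-linear `g`. -/
def map (f : M →ₗ[K] M') (g : N →ₗ[K] N') (hf : ∀ r m, f (ρ (op r) m) = ρ' (op r) (f m))
    (hg : ∀ r n, g (l r n) = l' r (g n)) : BalTensor ρ l →ₗ[K] BalTensor ρ' l' :=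
  lift ((tmulHom ρ' l').compl₁₂ f g) <| by
    intro r m n
    simp [hf, hg, tmul_act]

@[simp] theorem map_tmul (f : M →ₗ[K] M') (g : N →ₗ[K] N')
    (hf : ∀ r m, f (ρ (op r) m) = ρ' (op r) (f m)) (hg : ∀ r n, g (l r n) = l' r (g n))
    (m : M) (n : N) : map f g hf hg (tmul ρ l m n) = tmul ρ' l' (f m) (g n) := by
  simp [map]

/-- An action of `S` on `M` that commutes with that of `R` acts on `M ⊗_R N`
through the first factor. -/
def actFst (c : S →ₐ[K] Module.End K M) (hc : ∀ s r m, c s (ρ r m) = ρ r (c s m)) :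
    S →ₐ[K] Module.End K (BalTensor ρ l) :=
  AlgHom.ofLinearMap
    { toFun := fun s => map (c s) LinearMap.id (fun r m => hc s (op r) m) (id_lact l)
      map_add' := fun s s' => hom_ext fun m n => by simp
      map_smul' := fun k s => hom_ext fun m n => by simp }
    (hom_ext fun m n => by simp)
    (fun s s' => hom_ext fun m n => by simp)

/-- An action of `S` on `N` that commutes with that of `R` acts on `M ⊗_R N`
through the second factor. -/
def actSnd (c : S →ₐ[K] Module.End K N) (hc : ∀ s r n, c s (l r n) = l r (c s n)) :
    S →ₐ[K] Module.End K (BalTensor ρ l) :=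
  AlgHom.ofLinearMap
    { toFun := fun s => map LinearMap.id (c s) (id_ract ρ) (fun r n => hc s r n)
      map_add' := fun s s' => hom_ext fun m n => by simp
      map_smul' := fun k s => hom_ext fun m n => by simp }
    (hom_ext fun m n => by simp)
    (fun s s' => hom_ext fun m n => by simp)

@[simp] theorem actFst_tmul (c : S →ₐ[K] Module.End K M)
    (hc : ∀ s r m, c s (ρ r m) = ρ r (c s m)) (s : S) (m : M) (n : N) :
    actFst (l := l) c hc s (tmul ρ l m n) = tmul ρ l (c s m) n :=
  map_tmul (c s) LinearMap.id (fun r m => hc s (op r) m) (id_lact l) m n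

@[simp] theorem actSnd_tmul (c : S →ₐ[K] Module.End K N)
    (hc : ∀ s r n, c s (l r n) = l r (c s n)) (s : S) (m : M) (n : N) :
    actSnd (ρ := ρ) c hc s (tmul ρ l m n) = tmul ρ l m (c s n) :=
  map_tmul LinearMap.id (c s) (id_ract ρ) (fun r n => hc s r n) m n

theorem tmulHom_ract (l : R →ₐ[K] Module.End K N) (σ : Sᵐᵒᵖ →ₐ[K] Module.End K N)
    (h : ∀ r s n, l r (σ s n) = σ s (l r n)) (m : M) (s : S) (n : N) :
    tmulHom ρ l m (σ (op s) n) =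
      actSnd (ρ := ρ) σ (fun s r n => (h r s n).symm) (op s) (tmulHom ρ l m n) := by
  simp

/-- The rebracketing `M ⊗_R (N ⊗_S P) → (M ⊗_R N) ⊗_S P`, `m ⊗ (n ⊗ p) ↦ (m ⊗ n) ⊗ p`,
for a right `R`-module `M`, an `R`-`S`-bimodule `N` and a left `S`-module `P`. -/
def assocInv (ρ : Rᵐᵒᵖ →ₐ[K] Module.End K M) (l : R →ₐ[K] Module.End K N)
    (σ : Sᵐᵒᵖ →ₐ[K] Module.End K N) (k : S →ₐ[K] Module.End K P)
    (h : ∀ r s n, l r (σ s n) = σ s (l r n)) :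
    BalTensor ρ (actFst (l := k) l (fun r s n => h r s n)) →ₗ[K]
      BalTensor (actSnd (ρ := ρ) σ (fun s r n => (h r s n).symm)) k :=
  lift
    { toFun := fun m => map (tmulHom ρ l m) LinearMap.id (tmulHom_ract l σ h m) (id_lact k)
      map_add' := fun m m' => hom_ext fun n p => by simp
      map_smul' := fun c m => hom_ext fun n p => by simp }
    (by
      intro r m z
      obtain ⟨z, rfl⟩ := mk_surjective z
      induction z using TensorProduct.induction_on with
      | zero => simp
      | add x y hx hy => simp only [map_add] at *; rw [hx, hy]
      | tmul n p =>
        change map _ _ (tmulHom_ract l σ h _) (id_lact k) (tmul σ k n p) =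
          map _ _ (tmulHom_ract l σ h m) (id_lact k)
            (actFst l (fun r s n => h r s n) r (tmul σ k n p))
        simp [tmul_act])

@[simp] theorem assocInv_tmul (ρ : Rᵐᵒᵖ →ₐ[K] Module.End K M) (l : R →ₐ[K] Module.End K N)
    (σ : Sᵐᵒᵖ →ₐ[K] Module.End K N) (k : S →ₐ[K] Module.End K P)
    (h : ∀ r s n, l r (σ s n) = σ s (l r n)) (m : M) (n : N) (p : P) :
    assocInv ρ l σ k h (tmul _ _ m (tmul σ k n p)) = tmul _ _ (tmul ρ l m n) p := by
  simp [assocInv]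

end BalTensor

end Balanced

/-! Actions by multiplication. -/

section Mul

variable {K R A : Type*} [CommRing K] [Ring R] [Algebra K R] [Ring A] [Algebra K A]

/-- The left action `r ↦ (a ↦ f r * a)` of `R` on `A`. -/
def mulLeftAct (f : R →ₐ[K] A) : R →ₐ[K] Module.End K A :=
  (Algebra.lsmul K K A).comp f

/-- The right action `r ↦ (a ↦ a * f r)` of `R` on `A`. -/
def mulRightAct (f : R →ₐ[K] A) : Rᵐᵒᵖ →ₐ[K] Module.End K A :=
  (Algebra.lsmul K K A : Aᵐᵒᵖ →ₐ[K] Module.End K A).comp (AlgHom.op f)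

/-- The left action `r ↦ (a ↦ a * g r)` of `R` on `A`, for an anti-homomorphism `g`. -/
def antiMulAct (g : R →ₐ[K] Aᵐᵒᵖ) : R →ₐ[K] Module.End K A :=
  (Algebra.lsmul K K A : Aᵐᵒᵖ →ₐ[K] Module.End K A).comp g

@[simp] theorem mulLeftAct_apply (f : R →ₐ[K] A) (r : R) (a : A) :
    mulLeftAct f r a = f r * a := rfl

@[simp] theorem mulRightAct_apply (f : R →ₐ[K] A) (r : Rᵐᵒᵖ) (a : A) :
    mulRightAct f r a = a * f (unop r) := rfl

@[simp] theorem antiMulAct_apply (g : R →ₐ[K] Aᵐᵒᵖ) (r : R) (a : A) :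
    antiMulAct g r a = a * unop (g r) := rfl

theorem mulLeftAct_comm (f : R →ₐ[K] A) (a : A) (r : Rᵐᵒᵖ) (x : A) :
    mulLeftAct (AlgHom.id K A) a (mulRightAct f r x) =
      mulRightAct f r (mulLeftAct (AlgHom.id K A) a x) := by
  simp [mul_assoc]

theorem mulRightAct_comm (f : R →ₐ[K] A) (a : Aᵐᵒᵖ) (r : R) (x : A) :
    mulRightAct (AlgHom.id K A) a (mulLeftAct f r x) =
      mulLeftAct f r (mulRightAct (AlgHom.id K A) a x) := by
  simp [mul_assoc]

end Mul

/-! Right bialgebroids. -/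

/-- A source homomorphism `s : R → T` and a target anti-homomorphism `t : R → T` with commuting
images. They make `T` an `R`-`R`-bimodule by `r · x · r' = x * s r' * t r`. -/
structure SourceTarget (K R T : Type*) [CommRing K] [Ring R] [Algebra K R]
    [Ring T] [Algebra K T] where
  s : R →ₐ[K] T
  t : R →ₐ[K] Tᵐᵒᵖ
  comm : ∀ r r' : R, Commute (s r) (unop (t r'))

namespace SourceTarget

variable {K R T : Type*} [CommRing K] [Ring R] [Algebra K R] [Ring T] [Algebra K T]
  (X : SourceTarget K R T)

/-- `r · x = x * t r`. -/
def lact : R →ₐ[K] Module.End K T := antiMulAct X.t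

/-- `x · r = x * s r`. -/
def ract : Rᵐᵒᵖ →ₐ[K] Module.End K T := mulRightAct X.s

theorem act_comm (r : R) (r' : Rᵐᵒᵖ) (x : T) : X.lact r (X.ract r' x) = X.ract r' (X.lact r x) := by
  simp only [lact, ract, antiMulAct_apply, mulRightAct_apply, mul_assoc]
  rw [(X.comm (unop r') r).eq]

/-- `T ⊗_R T`. -/
abbrev TT : Type _ := BalTensor X.ract X.lact

/-- `r · (x ⊗ y) = (r · x) ⊗ y`. -/
abbrev lactTT : R →ₐ[K] Module.End K X.TT :=
  BalTensor.actFst X.lact (fun r r' x => X.act_comm r r' x)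

/-- `(x ⊗ y) · r = x ⊗ (y · r)`. -/
abbrev ractTT : Rᵐᵒᵖ →ₐ[K] Module.End K X.TT :=
  BalTensor.actSnd X.ract (fun r' r x => (X.act_comm r r' x).symm)

/-- `T` as a left `R`-module, `r · x = x * t r`. -/
@[reducible] def leftModule : Module R T := Module.compHom T (X.t : R →+* Tᵐᵒᵖ)

end SourceTarget

/-- A right bialgebroid `(T, R, s, t, Δ, ε)` over the `K`-algebra `R`: an `R`-coring structure on
the `R`-`R`-bimodule `T`, compatible with the multiplication of `T`.

By `Δ_takeuchi`, the product `(x ⊗ y)(x' ⊗ y') = x x' ⊗ y y'` of two values of `Δ` does not depend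
on the choice of representatives in `T ⊗_K T`, and `Δ_mul` says `Δ (x y) = Δ x Δ y`. -/
structure RightBialgebroid (K R T : Type*) [CommRing K] [Ring R] [Algebra K R]
    [Ring T] [Algebra K T] extends SourceTarget K R T where
  Δ : T →ₗ[K] toSourceTarget.TT
  ε : T →ₗ[K] R
  Δ_left : ∀ r x, Δ (toSourceTarget.lact r x) = toSourceTarget.lactTT r (Δ x)
  Δ_right : ∀ r x, Δ (toSourceTarget.ract (op r) x) = toSourceTarget.ractTT (op r) (Δ x)
  ε_left : ∀ r x, ε (toSourceTarget.lact r x) = r * ε x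
  ε_right : ∀ r x, ε (toSourceTarget.ract (op r) x) = ε x * r
  /-- `(Δ ⊗ id) Δ = (id ⊗ Δ) Δ`. -/
  coassoc : ∀ x,
    BalTensor.map (ρ' := toSourceTarget.ractTT) (l' := toSourceTarget.lact)
        Δ LinearMap.id Δ_right (BalTensor.id_lact _) (Δ x) =
      BalTensor.assocInv _ _ _ _ toSourceTarget.act_comm
        (BalTensor.map (ρ' := toSourceTarget.ract) (l' := toSourceTarget.lactTT)
          LinearMap.id Δ (BalTensor.id_ract _) Δ_left (Δ x))
  /-- `ε(x₁) · x₂ = x`. -/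
  counit_left : ∀ x, BalTensor.lift (toSourceTarget.lact.toLinearMap ∘ₗ ε)
    (fun r m n => by simp [ε_right]) (Δ x) = x
  /-- `x₁ · ε(x₂) = x`. -/
  counit_right : ∀ x, BalTensor.lift
    (((LinearMap.mul K T).compl₂ (s.toLinearMap ∘ₗ ε)))
    (fun r m n => by simp [ε_left, ← mul_assoc]; rfl) (Δ x) = x
  Δ_one : Δ 1 = BalTensor.tmul _ _ 1 1
  ε_one : ε 1 = 1
  ε_mul_t : ∀ x y, ε (x * y) = ε (unop (t (ε x)) * y)
  ε_mul_s : ∀ x y, ε (x * y) = ε (s (ε x) * y)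
  /-- `s r x₁ ⊗ x₂ = x₁ ⊗ t r x₂`. -/
  Δ_takeuchi : ∀ (r : R) (x : T) (z : T ⊗[K] T), BalTensor.mk _ _ z = Δ x →
    BalTensor.mk toSourceTarget.ract toSourceTarget.lact ((s r ⊗ₜ[K] 1) * z) =
      BalTensor.mk toSourceTarget.ract toSourceTarget.lact ((1 ⊗ₜ[K] unop (t r)) * z)
  Δ_mul : ∀ (x y : T) (z w : T ⊗[K] T), BalTensor.mk _ _ z = Δ x → BalTensor.mk _ _ w = Δ y →
    Δ (x * y) = BalTensor.mk _ _ (z * w)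

namespace RightBialgebroid

variable {K R T : Type*} [CommRing K] [Ring R] [Algebra K R] [Ring T] [Algebra K T]

/-- The left `R`-module `T` (with `r · x = x * t r`) is finitely generated projective. -/
def LeftFiniteProjective (𝒯 : RightBialgebroid K R T) : Prop :=
  @Module.Finite R T _ _ 𝒯.leftModule ∧ @Module.Projective R _ T _ 𝒯.leftModule

end RightBialgebroid

/-! Comodule algebras. -/

section Comodule

variable {K R T : Type*} [CommRing K] [Ring R] [Algebra K R] [Ring T] [Algebra K T]

/-- `A ⊗_R T`, for `A` a right `R`-module by `a · r = a * η r`. -/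
abbrev SourceTarget.AT {A : Type*} [Ring A] [Algebra K A] (X : SourceTarget K R T)
    (η : R →ₐ[K] A) : Type _ :=
  BalTensor (mulRightAct η) X.lact

/-- `(a ⊗ x) · r = a ⊗ (x · r)`. -/
abbrev SourceTarget.ractAT {A : Type*} [Ring A] [Algebra K A] (X : SourceTarget K R T)
    (η : R →ₐ[K] A) : Rᵐᵒᵖ →ₐ[K] Module.End K (X.AT η) :=
  BalTensor.actSnd X.ract (fun r' r x => (X.act_comm r r' x).symm)

/-- A right `T`-comodule algebra structure on the `K`-algebra `A`: a homomorphism `η : R → A` and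
a coaction `δ : A → A ⊗_R T` making `A` a right comodule over the `R`-coring `T`, compatible with
the multiplication of `A`.

By `δ_takeuchi` (`η r a₀ ⊗ a₁ = a₀ ⊗ t r a₁`), the product `(a ⊗ x)(a' ⊗ x') = a a' ⊗ x x'` of two
values of `δ` does not depend on the choice of representatives in `A ⊗_K T`. -/
structure ComoduleAlgebra (𝒯 : RightBialgebroid K R T) (A : Type*) [Ring A] [Algebra K A] where
  η : R →ₐ[K] A
  δ : A →ₗ[K] 𝒯.AT η
  δ_right : ∀ r a, δ (mulRightAct η (op r) a) = 𝒯.ractAT η (op r) (δ a)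
  /-- `(δ ⊗ id) δ = (id ⊗ Δ) δ`. -/
  coassoc : ∀ a,
    BalTensor.map (ρ' := 𝒯.ractAT η) (l' := 𝒯.lact) δ LinearMap.id δ_right
        (BalTensor.id_lact _) (δ a) =
      BalTensor.assocInv _ _ _ _ 𝒯.act_comm
        (BalTensor.map (ρ' := mulRightAct η) (l' := 𝒯.lactTT)
          LinearMap.id 𝒯.Δ (BalTensor.id_ract _) 𝒯.Δ_left (δ a))
  /-- `a₀ ε(a₁) = a`. -/
  counit : ∀ a, BalTensor.lift ((LinearMap.mul K A).compl₂ (η.toLinearMap ∘ₗ 𝒯.ε))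
    (fun r m n => by simp [𝒯.ε_left, mul_assoc]) (δ a) = a
  δ_one : δ 1 = BalTensor.tmul _ _ 1 1
  δ_takeuchi : ∀ (r : R) (a : A) (z : A ⊗[K] T), BalTensor.mk _ _ z = δ a →
    BalTensor.mk (mulRightAct η) 𝒯.lact ((η r ⊗ₜ[K] 1) * z) =
      BalTensor.mk (mulRightAct η) 𝒯.lact ((1 ⊗ₜ[K] unop (𝒯.t r)) * z)
  δ_mul : ∀ (a b : A) (z w : A ⊗[K] T), BalTensor.mk _ _ z = δ a → BalTensor.mk _ _ w = δ b →
    δ (a * b) = BalTensor.mk _ _ (z * w)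

end Comodule

/-! The tensor square of an extension `B ⊆ A`, and its `B`-central elements. -/

section TensorSquare

variable {K A : Type*} [CommRing K] [Ring A] [Algebra K A] (B : Subalgebra K A)

/-- `A ⊗_B A`. -/
abbrev TensorSq : Type _ := BalTensor (mulRightAct B.val) (mulLeftAct B.val)

namespace TensorSq

/-- The left `A`-action `a (x ⊗ y) = a x ⊗ y`. -/
def lactA : A →ₐ[K] Module.End K (TensorSq B) :=
  BalTensor.actFst (mulLeftAct (AlgHom.id K A)) (mulLeftAct_comm B.val)

/-- The right `A`-action `(x ⊗ y) a = x ⊗ y a`. -/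
def ractA : Aᵐᵒᵖ →ₐ[K] Module.End K (TensorSq B) :=
  BalTensor.actSnd (mulRightAct (AlgHom.id K A)) (mulRightAct_comm B.val)

variable {B}

/-- The pure tensor `x ⊗_B y`. -/
def tmul (B : Subalgebra K A) (x y : A) : TensorSq B := BalTensor.tmul _ _ x y

@[simp] theorem lactA_tmul (a x y : A) : lactA B a (tmul B x y) = tmul B (a * x) y := by
  simp [lactA, tmul]

@[simp] theorem ractA_tmul (a : Aᵐᵒᵖ) (x y : A) :
    ractA B a (tmul B x y) = tmul B x (y * unop a) := by
  simp [ractA, tmul]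

theorem tmul_mul (b : B) (x y : A) : tmul B (x * b) y = tmul B x (b * y) :=
  BalTensor.tmul_act (ρ := mulRightAct B.val) (l := mulLeftAct B.val) b x y

theorem hom_ext {P : Type*} [AddCommGroup P] [Module K P] {f g : TensorSq B →ₗ[K] P}
    (h : ∀ x y, f (tmul B x y) = g (tmul B x y)) : f = g :=
  BalTensor.hom_ext h

theorem lactA_ractA (a : A) (a' : Aᵐᵒᵖ) (z : TensorSq B) :
    lactA B a (ractA B a' z) = ractA B a' (lactA B a z) := by
  have : lactA B a ∘ₗ ractA B a' = ractA B a' ∘ₗ lactA B a := hom_ext fun x y => by simp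
  exact LinearMap.congr_fun this z

/-- The multiplication `x ⊗ y ↦ x y`. -/
def mulMap (B : Subalgebra K A) : TensorSq B →ₗ[K] A :=
  BalTensor.lift (LinearMap.mul K A) (fun b x y => by simp [mul_assoc])

end TensorSq

/-- `(A ⊗_B A)^B = {z | b z = z b for all b ∈ B}`. -/
def BInv : Submodule K (TensorSq B) where
  carrier := {z | ∀ b ∈ B, TensorSq.lactA B b z = TensorSq.ractA B (op b) z}
  add_mem' := fun hx hy b hb => by simp [hx b hb, hy b hb]
  zero_mem' := fun b _ => by simp
  smul_mem' := fun k x hx b hb => by simp [hx b hb]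

namespace BInv

variable {B}

/-- For `t ∈ (A ⊗_B A)^B`, the map `x ⊗ y ↦ x t y` on `A ⊗_B A`. -/
def sandwich (t : BInv B) : TensorSq B →ₗ[K] TensorSq B :=
  BalTensor.lift
    (LinearMap.mk₂ K (fun x y => TensorSq.lactA B x (TensorSq.ractA B (op y) t))
      (by intros; simp) (by intros; simp) (by intros; simp) (by intros; simp))
    (by
      intro b x y
      have h := t.2 b b.2
      simp only [LinearMap.mk₂_apply, mulRightAct_apply, mulLeftAct_apply, unop_op, map_mul,
        op_mul, Module.End.mul_apply, Subalgebra.coe_val]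
      rw [TensorSq.lactA_ractA, h])

@[simp] theorem sandwich_tmul (t : BInv B) (x y : A) :
    sandwich t (TensorSq.tmul B x y) = TensorSq.lactA B x (TensorSq.ractA B (op y) t) := by
  simp [sandwich, TensorSq.tmul]

theorem sandwich_lactA (t : BInv B) (a : A) (z : TensorSq B) :
    sandwich t (TensorSq.lactA B a z) = TensorSq.lactA B a (sandwich t z) := by
  have : sandwich t ∘ₗ TensorSq.lactA B a = TensorSq.lactA B a ∘ₗ sandwich t :=
    TensorSq.hom_ext fun x y => by simp
  exact LinearMap.congr_fun this z

theorem sandwich_ractA (t : BInv B) (a : Aᵐᵒᵖ) (z : TensorSq B) :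
    sandwich t (TensorSq.ractA B a z) = TensorSq.ractA B a (sandwich t z) := by
  have : sandwich t ∘ₗ TensorSq.ractA B a = TensorSq.ractA B a ∘ₗ sandwich t :=
    TensorSq.hom_ext fun x y => by simp [TensorSq.lactA_ractA]
  exact LinearMap.congr_fun this z

/-- The product `t t' = t'¹ t¹ ⊗ t² t'²`, that is, `t'¹ t t'²`. -/
instance : Mul (BInv B) :=
  ⟨fun t t' => ⟨sandwich t t', fun b hb => by
    rw [← sandwich_lactA, ← sandwich_ractA, t'.2 b hb]⟩⟩

/-- The unit `1 ⊗ 1`. -/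
instance : One (BInv B) :=
  ⟨⟨TensorSq.tmul B 1 1, fun b hb => by
    simpa using TensorSq.tmul_mul (B := B) ⟨b, hb⟩ 1 1⟩⟩

theorem coe_mul (t t' : BInv B) : ((t * t' : BInv B) : TensorSq B) = sandwich t t' := rfl

theorem coe_one : ((1 : BInv B) : TensorSq B) = TensorSq.tmul B 1 1 := rfl

theorem sandwich_mul (t t' : BInv B) (z : TensorSq B) :
    sandwich (t * t') z = sandwich t (sandwich t' z) := by
  have : sandwich (t * t') = sandwich t ∘ₗ sandwich t' :=
    TensorSq.hom_ext fun x y => by simp [sandwich_lactA, sandwich_ractA, coe_mul]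
  exact LinearMap.congr_fun this z

theorem sandwich_one (z : TensorSq B) : sandwich (1 : BInv B) z = z := by
  have : sandwich (1 : BInv B) = LinearMap.id := TensorSq.hom_ext fun x y => by simp [coe_one]
  exact LinearMap.congr_fun this z

theorem sandwich_add (t t' : BInv B) (z : TensorSq B) :
    sandwich (t + t') z = sandwich t z + sandwich t' z := by
  have : sandwich (t + t') = sandwich t + sandwich t' := TensorSq.hom_ext fun x y => by simp
  exact LinearMap.congr_fun this z

theorem sandwich_smul (k : K) (t : BInv B) (z : TensorSq B) :
    sandwich (k • t) z = k • sandwich t z := by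
  have : sandwich (k • t) = k • sandwich t := TensorSq.hom_ext fun x y => by simp
  exact LinearMap.congr_fun this z

instance : Ring (BInv B) :=
  { (inferInstance : AddCommGroup (BInv B)), (inferInstance : Mul (BInv B)),
    (inferInstance : One (BInv B)) with
    left_distrib := fun a b c => Subtype.ext (by simp [coe_mul])
    right_distrib := fun a b c => Subtype.ext (by simp [coe_mul, sandwich_add])
    zero_mul := fun a => Subtype.ext (by
      have h := sandwich_smul (0 : K) (0 : BInv B) (a : TensorSq B)
      simpa [coe_mul] using h)
    mul_zero := fun a => Subtype.ext (by simp [coe_mul])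
    mul_assoc := fun a b c => Subtype.ext (by simp [coe_mul, sandwich_mul])
    one_mul := fun a => Subtype.ext (by simp [coe_mul, sandwich_one])
    mul_one := fun a => Subtype.ext (by simp [coe_mul, coe_one]) }

instance : Algebra K (BInv B) :=
  Algebra.ofModule (fun k x y => Subtype.ext (sandwich_smul k x y))
    (fun k x y => Subtype.ext (map_smul (sandwich x) k (y : TensorSq B)))

theorem map_lact_of (γ : A →ₗ[K] A) (hl : ∀ b ∈ B, ∀ a, γ (b * a) = b * γ a) (b : B) (a : A) :
    γ (mulLeftAct B.val b a) = mulLeftAct B.val b (γ a) :=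
  hl b b.2 a

/-- `t ↦ t¹ ⊗ γ(t²)`, for a `B`-`B`-bimodule endomorphism `γ` of `A`. -/
def mapSnd (γ : A →ₗ[K] A) (hl : ∀ b ∈ B, ∀ a, γ (b * a) = b * γ a)
    (hr : ∀ b ∈ B, ∀ a, γ (a * b) = γ a * b) (t : BInv B) : BInv B :=
  ⟨BalTensor.map LinearMap.id γ (BalTensor.id_ract _) (map_lact_of γ hl) (t : TensorSq B), by
    set F : TensorSq B →ₗ[K] TensorSq B :=
      BalTensor.map LinearMap.id γ (BalTensor.id_ract _) (map_lact_of γ hl) with hF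
    have hFt : ∀ x y, F (TensorSq.tmul B x y) = TensorSq.tmul B x (γ y) := fun x y => by
      simp [hF, TensorSq.tmul]
    intro b hb
    have h1 : TensorSq.lactA B b ∘ₗ F = F ∘ₗ TensorSq.lactA B b :=
      TensorSq.hom_ext fun x y => by simp [hFt]
    have h2 : TensorSq.ractA B (op b) ∘ₗ F = F ∘ₗ TensorSq.ractA B (op b) :=
      TensorSq.hom_ext fun x y => by simp [hFt, hr b hb]
    have e1 := LinearMap.congr_fun h1 (t : TensorSq B)
    have e2 := LinearMap.congr_fun h2 (t : TensorSq B)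
    simp only [LinearMap.comp_apply] at e1 e2
    rw [e1, e2, t.2 b hb]⟩

end BInv

/-- Right depth two quasibases of the extension `B ⊆ A`: elements `u j ∈ (A ⊗_B A)^B` and
`B`-`B`-bimodule endomorphisms `γ j` of `A` with `a ⊗ a' = ∑ j, a γ j(a') u j`. -/
structure RightD2Quasibases where
  m : ℕ
  u : Fin m → BInv B
  γ : Fin m → (A →ₗ[K] A)
  γ_left : ∀ j, ∀ b ∈ B, ∀ a, γ j (b * a) = b * γ j a
  γ_right : ∀ j, ∀ b ∈ B, ∀ a, γ j (a * b) = γ j a * b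
  eq : ∀ a a' : A, TensorSq.tmul B a a' =
    ∑ j, TensorSq.lactA B (a * γ j a') (u j : TensorSq B)

end TensorSquare

/-! Coinvariants and the Galois map. -/

namespace ComoduleAlgebra

variable {K R T A : Type*} [CommRing K] [Ring R] [Algebra K R] [Ring T] [Algebra K T]
  [Ring A] [Algebra K A] {𝒯 : RightBialgebroid K R T} (𝒜 : ComoduleAlgebra 𝒯 A)

/-- The pure tensor `a ⊗_R x`. -/
def tmul (a : A) (x : T) : 𝒯.AT 𝒜.η := BalTensor.tmul _ _ a x

/-- The coinvariants `{a | δ a = a ⊗ 1}`. -/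
def coinv : Subalgebra K A where
  carrier := {a | 𝒜.δ a = 𝒜.tmul a 1}
  mul_mem' := by
    intro a b ha hb
    have h := 𝒜.δ_mul a b (a ⊗ₜ[K] 1) (b ⊗ₜ[K] 1) ha.symm hb.symm
    simpa [tmul, BalTensor.tmul] using h
  add_mem' := by
    intro a b ha hb
    change 𝒜.δ a = _ at ha
    change 𝒜.δ b = _ at hb
    change 𝒜.δ (a + b) = _
    rw [map_add, ha, hb]
    simp [tmul]
  algebraMap_mem' := by
    intro k
    change 𝒜.δ _ = _
    rw [Algebra.algebraMap_eq_smul_one, map_smul, 𝒜.δ_one]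
    simp [tmul]

/-- The left `A`-action `a (a' ⊗ x) = a a' ⊗ x` on `A ⊗_R T`. -/
def lactA : A →ₐ[K] Module.End K (𝒯.AT 𝒜.η) :=
  BalTensor.actFst (mulLeftAct (AlgHom.id K A)) (mulLeftAct_comm 𝒜.η)

theorem δ_coinv_mul (b : A) (hb : b ∈ 𝒜.coinv) (a : A) :
    𝒜.δ (b * a) = 𝒜.lactA b (𝒜.δ a) := by
  obtain ⟨w, hw⟩ := BalTensor.mk_surjective (𝒜.δ a)
  rw [𝒜.δ_mul b a (b ⊗ₜ[K] 1) w hb.symm hw, ← hw]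
  clear hw
  induction w using TensorProduct.induction_on with
  | zero => simp
  | add x y hx hy => simp only [mul_add, map_add, hx, hy]
  | tmul x y =>
    have h := BalTensor.actFst_tmul (l := 𝒯.lact) _ (mulLeftAct_comm 𝒜.η) b x y
    rw [Algebra.TensorProduct.tmul_mul_tmul, one_mul]
    exact h.symm

/-- The Galois map `A ⊗_B A → A ⊗_R T`, `a ⊗ a' ↦ a a'₀ ⊗ a'₁`, for `B` the coinvariants. -/
def galoisMap : TensorSq 𝒜.coinv →ₗ[K] 𝒯.AT 𝒜.η :=
  BalTensor.lift (𝒜.lactA.toLinearMap.compl₂ 𝒜.δ) (by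
    intro b x y
    simp [δ_coinv_mul 𝒜 (b : A) b.2 y])

/-- The Galois map is a split monomorphism of `A`-`B`-bimodules, where `B`, the coinvariants, acts
on `A ⊗_R T` from the right by `(a ⊗ x) b = a b ⊗ x`. -/
def GaloisMapSplitMonic : Prop :=
  ∃ σ : 𝒯.AT 𝒜.η →ₗ[K] TensorSq 𝒜.coinv,
    (∀ a a' x, σ (𝒜.tmul (a * a') x) = TensorSq.lactA 𝒜.coinv a (σ (𝒜.tmul a' x))) ∧
    (∀ a x, ∀ b ∈ 𝒜.coinv,
      σ (𝒜.tmul (a * b) x) = TensorSq.ractA 𝒜.coinv (op b) (σ (𝒜.tmul a x))) ∧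
    ∀ z, σ (𝒜.galoisMap z) = z

/-- `A` is a right `T`-Galois extension of the subalgebra `B`. -/
def IsGaloisOver (B : Subalgebra K A) : Prop :=
  𝒜.coinv = B ∧ Function.Bijective 𝒜.galoisMap

end ComoduleAlgebra

/-! The canonical structures on `(A ⊗_B A)^B`. -/

section Canonical

variable {K A : Type*} [CommRing K] [Ring A] [Algebra K A] {B : Subalgebra K A}

/-- `𝒯` is the bialgebroid structure of `(A ⊗_B A)^B` over the centralizer of `B` in `A`:
`s r = 1 ⊗ r`, `t r = r ⊗ 1`, `ε x = x¹ x²` and `Δ x = ∑ j, (x¹ ⊗ γ j(x²)) ⊗ u j`. -/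
structure IsCanonicalBialgebroid (q : RightD2Quasibases B)
    (𝒯 : RightBialgebroid K (Subalgebra.centralizer K (B : Set A)) (BInv B)) : Prop where
  s_eq : ∀ r, (𝒯.s r : TensorSq B) = TensorSq.tmul B 1 r
  t_eq : ∀ r, ((unop (𝒯.t r) : BInv B) : TensorSq B) = TensorSq.tmul B r 1
  ε_eq : ∀ x : BInv B, (𝒯.ε x : A) = TensorSq.mulMap B x
  Δ_eq : ∀ x : BInv B, 𝒯.Δ x =
    ∑ j, BalTensor.tmul _ _ (BInv.mapSnd (q.γ j) (q.γ_left j) (q.γ_right j) x) (q.u j)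

/-- The comodule algebra structure on `A` given by the inclusion of the centralizer of `B`
and `δ a = ∑ j, γ j(a) ⊗ u j`. -/
structure IsCanonicalCoaction (q : RightD2Quasibases B)
    {𝒯 : RightBialgebroid K (Subalgebra.centralizer K (B : Set A)) (BInv B)}
    (𝒜 : ComoduleAlgebra 𝒯 A) : Prop where
  η_eq : ∀ r, 𝒜.η r = r
  δ_eq : ∀ a : A, 𝒜.δ a = ∑ j, 𝒜.tmul (q.γ j a) (q.u j)

end Canonical

end

/-! The hypotheses are used only to produce right depth two quasibases. Let `x i`, `f i` be a dual
basis of the left `R`-module `T`, and let `σ` split the Galois map `β`. Put `u i = σ(1 ⊗ x i)` and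
`γ i (a) = a₀ f i(a₁)`. Expanding `β(a ⊗ a')` in the dual basis and applying `σ` gives `a ⊗ a' = ∑ a
γ i(a') u i` (`GaloisMapSplitMonic.nonempty_quasibases`). Right `B`-linearity of `γ i` needs that
coinvariants commute with the image of `R` (`coinv_comm`).

Everything else except the coinvariants is formal for any quasibases. Write `T'` for `(A ⊗_B A)^B`
and `R'` for the centralizer of `B`. The functionals `t ↦ t¹ γ j(t²)` and the elements `u j` form a
dual basis of the left `R'`-module `T'` (`sum_lact`), so an element of `M ⊗_{R'} T'` is determined
by its coordinates in `M` (`coord_ext`). The coordinates of `Δ x` are `x¹ ⊗ γ k(x²)`, those of `δ a`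
are `γ k(a)`. Most axioms, compared in coordinates, reduce to `∑ γ j(a) F(u j) = F(1 ⊗ a)` for a
left `A`-linear `F : A ⊗_B A → A` (`sum_mul`).

The new Galois map has coordinates `x γ k(y)`. These recover `x ⊗ y`, whence injectivity, and `a ⊗
t` is the image of `a t`, whence surjectivity. By injectivity, `a` is coinvariant exactly when `1 ⊗
a = a ⊗ 1` in `A ⊗_B A`; the original `β` turns this equation into `δ a = a ⊗ 1`, that is, `a ∈ B`.
-/

noncomputable section

/-! ### Multiplying representatives of elements of a balanced tensor product. -/

section BalancedProducts

variable {K R T M : Type*} [CommRing K] [Ring R] [Algebra K R] [Ring T] [Algebra K T]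
  [Ring M] [Algebra K M] (X : SourceTarget K R T) (f : R →ₐ[K] M)

theorem BalTensor.mk_tmul {K R M N : Type*} [CommRing K] [Ring R] [Algebra K R]
    [AddCommGroup M] [Module K M] [AddCommGroup N] [Module K N]
    (ρ : Rᵐᵒᵖ →ₐ[K] Module.End K M) (l : R →ₐ[K] Module.End K N) (m : M) (n : N) :
    BalTensor.mk ρ l (m ⊗ₜ[K] n) = BalTensor.tmul ρ l m n := rfl

theorem BalTensor.induction_on {K R M N : Type*} [CommRing K] [Ring R] [Algebra K R]
    [AddCommGroup M] [Module K M] [AddCommGroup N] [Module K N]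
    {ρ : Rᵐᵒᵖ →ₐ[K] Module.End K M} {l : R →ₐ[K] Module.End K N} {p : BalTensor ρ l → Prop}
    (z : BalTensor ρ l) (tmul : ∀ m n, p (tmul ρ l m n))
    (add : ∀ z w, p z → p w → p (z + w)) : p z := by
  obtain ⟨z, rfl⟩ := BalTensor.mk_surjective z
  induction z using TensorProduct.induction_on with
  | zero => simpa [BalTensor.tmul] using tmul 0 0
  | add x y hx hy => rw [map_add]; exact add _ _ hx hy
  | tmul m n => exact tmul m n

namespace SourceTarget

/-- The balancing relations come from right multiplications, which commute with left multiplication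
by `m ⊗ n`; the latter therefore descends to the quotient. -/
theorem mk_mul_left_congr (z : M ⊗[K] T) {w w' : M ⊗[K] T}
    (h : BalTensor.mk (mulRightAct f) X.lact w = BalTensor.mk (mulRightAct f) X.lact w') :
    BalTensor.mk (mulRightAct f) X.lact (z * w) = BalTensor.mk (mulRightAct f) X.lact (z * w') := by
  induction z using TensorProduct.induction_on with
  | zero => simp
  | add x y hx hy => simp only [add_mul, map_add, hx, hy]
  | tmul m n =>
    have key : ∀ w, BalTensor.mk (mulRightAct f) X.lact ((m ⊗ₜ[K] n) * w) =
        BalTensor.map (ρ := mulRightAct f) (l := X.lact) (ρ' := mulRightAct f) (l' := X.lact)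
          (LinearMap.mulLeft K m) (LinearMap.mulLeft K n) (by simp [mul_assoc])
          (by simp [SourceTarget.lact, mul_assoc]) (BalTensor.mk _ _ w) := by
      intro w
      induction w using TensorProduct.induction_on with
      | zero => simp
      | add x y hx hy => simp only [mul_add, map_add, hx, hy]
        | tmul p q =>
        rw [Algebra.TensorProduct.tmul_mul_tmul]
        exact (BalTensor.map_tmul (ρ := mulRightAct f) (l := X.lact) (ρ' := mulRightAct f)
        (l' := X.lact) (LinearMap.mulLeft K m) (LinearMap.mulLeft K n) _ _ p q).symm
    rw [key, key, h]

/-- Right multiplication by `w` respects the balancing relations as soon as `w` satisfies the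
Takeuchi condition. -/
theorem mk_mul_right_congr {z z' : M ⊗[K] T} (w : M ⊗[K] T)
    (hw : ∀ r, BalTensor.mk (mulRightAct f) X.lact ((f r ⊗ₜ[K] 1) * w) =
      BalTensor.mk (mulRightAct f) X.lact ((1 ⊗ₜ[K] unop (X.t r)) * w))
    (h : BalTensor.mk (mulRightAct f) X.lact z = BalTensor.mk (mulRightAct f) X.lact z') :
    BalTensor.mk (mulRightAct f) X.lact (z * w) = BalTensor.mk (mulRightAct f) X.lact (z' * w) := by
  have hle : balRel (mulRightAct f) X.lact ≤
      LinearMap.ker (BalTensor.mk (mulRightAct f) X.lact ∘ₗ LinearMap.mulRight K w) := by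
    unfold balRel
    rw [Submodule.span_le]
    rintro _ ⟨r, m, n, rfl⟩
    -- Each generating relation is `m ⊗ n` times `f r ⊗ 1 - 1 ⊗ t r`, and the Takeuchi condition
    -- kills the second factor against `w`.
    have e : ((mulRightAct f (op r) m) ⊗ₜ[K] n - m ⊗ₜ[K] X.lact r n) * w =
        (m ⊗ₜ[K] n) * ((f r ⊗ₜ[K] 1) * w) - (m ⊗ₜ[K] n) * ((1 ⊗ₜ[K] unop (X.t r)) * w) := by
      simp [sub_mul, ← mul_assoc, SourceTarget.lact]
    simp only [SetLike.mem_coe, LinearMap.mem_ker, LinearMap.comp_apply, LinearMap.mulRight_apply]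
    rw [e, map_sub, mk_mul_left_congr X f (m ⊗ₜ[K] n) (hw r), sub_self]
  have := hle ((Submodule.Quotient.eq _).1 h)
  simpa [sub_mul, sub_eq_zero] using this

end SourceTarget

end BalancedProducts

/-! ### Left `A`-linear maps out of `A ⊗_B A`. -/

section D2

variable {K A : Type*} [CommRing K] [Ring A] [Algebra K A] {B : Subalgebra K A}

namespace TensorSq

theorem induction_on {p : TensorSq B → Prop} (z : TensorSq B) (tmul : ∀ x y, p (tmul B x y))
    (add : ∀ z w, p z → p w → p (z + w)) : p z :=
  BalTensor.induction_on z tmul add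

theorem sum_tmul {ι : Type*} (s : Finset ι) (x : A) (f : ι → A) :
    ∑ j ∈ s, tmul B x (f j) = tmul B x (∑ j ∈ s, f j) :=
  (map_sum (BalTensor.tmulHom _ _ x) f s).symm

@[simp] theorem mulMap_tmul (x y : A) : mulMap B (tmul B x y) = x * y := by
  simp [mulMap, tmul]

theorem mulMap_lactA (a : A) (z : TensorSq B) : mulMap B (lactA B a z) = a * mulMap B z := by
  induction z using induction_on with
  | tmul x y => simp [mul_assoc]
  | add z w hz hw => simp [hz, hw, mul_add]

theorem mulMap_ractA (a : Aᵐᵒᵖ) (z : TensorSq B) :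
    mulMap B (ractA B a z) = mulMap B z * unop a := by
  induction z using induction_on with
  | tmul x y => simp [mul_assoc]
  | add z w hz hw => simp [hz, hw, add_mul]

/-- `x ⊗ y ↦ x ⊗ γ y` for a left `B`-linear `γ`. -/
def mapSnd (γ : A →ₗ[K] A) (hl : ∀ b ∈ B, ∀ a, γ (b * a) = b * γ a) :
    TensorSq B →ₗ[K] TensorSq B :=
  BalTensor.map LinearMap.id γ (BalTensor.id_ract _) (BInv.map_lact_of γ hl)

variable (γ : A →ₗ[K] A) (hl : ∀ b ∈ B, ∀ a, γ (b * a) = b * γ a)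

@[simp] theorem mapSnd_tmul (x y : A) : mapSnd γ hl (tmul B x y) = tmul B x (γ y) := by
  simp [mapSnd, tmul]

theorem mapSnd_lactA (a : A) (z : TensorSq B) :
    mapSnd γ hl (lactA B a z) = lactA B a (mapSnd γ hl z) := by
  induction z using induction_on with
  | tmul x y => simp
  | add z w hz hw => simp [hz, hw]

/-- `x ⊗ y ↦ x * γ y` for a left `B`-linear `γ`. -/
def contract : TensorSq B →ₗ[K] A := mulMap B ∘ₗ mapSnd γ hl

@[simp] theorem contract_tmul (x y : A) : contract γ hl (tmul B x y) = x * γ y := by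
  simp [contract]

theorem contract_lactA (a : A) (z : TensorSq B) :
    contract γ hl (lactA B a z) = a * contract γ hl z := by
  simp [contract, mapSnd_lactA, mulMap_lactA]

end TensorSq

/-! ### Source, target and counit of `(A ⊗_B A)^B`. -/

namespace BInv

theorem mulMap_mem (x : BInv B) :
    TensorSq.mulMap B x ∈ Subalgebra.centralizer K (B : Set A) := by
  rw [Subalgebra.mem_centralizer_iff]
  intro b hb
  rw [← TensorSq.mulMap_lactA, x.2 b hb, TensorSq.mulMap_ractA, unop_op]

variable (B) in
/-- The source map `r ↦ 1 ⊗ r` on the centralizer of `B`. -/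
def source : Subalgebra.centralizer K (B : Set A) →ₐ[K] BInv B :=
  AlgHom.ofLinearMap
    { toFun := fun r => ⟨TensorSq.tmul B 1 r, fun b hb => by
        have h := TensorSq.tmul_mul (B := B) ⟨b, hb⟩ 1 (r : A)
        have hr := Subalgebra.mem_centralizer_iff K |>.1 r.2 b hb
        simpa [hr] using h⟩
      map_add' := fun r r' => Subtype.ext (by simp [TensorSq.tmul])
      map_smul' := fun k r => Subtype.ext (by simp [TensorSq.tmul]) }
    (Subtype.ext (by simp [coe_one]))
    (fun r r' => Subtype.ext (by simp [coe_mul]))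

variable (B) in
/-- The target map `r ↦ r ⊗ 1` on the centralizer of `B`. -/
def target : Subalgebra.centralizer K (B : Set A) →ₐ[K] (BInv B)ᵐᵒᵖ :=
  AlgHom.ofLinearMap
    { toFun := fun r => op ⟨TensorSq.tmul B r 1, fun b hb => by
        have h := TensorSq.tmul_mul (B := B) ⟨b, hb⟩ (r : A) 1
        have hr := Subalgebra.mem_centralizer_iff K |>.1 r.2 b hb
        simpa [hr] using h⟩
      map_add' := fun r r' => unop_injective (Subtype.ext (by simp [TensorSq.tmul]))
      map_smul' := fun k r => unop_injective (Subtype.ext (by simp [TensorSq.tmul])) }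
    (unop_injective (Subtype.ext (by simp [coe_one])))
    (fun r r' => unop_injective (Subtype.ext (by simp [coe_mul])))

@[simp] theorem coe_source (r : Subalgebra.centralizer K (B : Set A)) :
    (source B r : TensorSq B) = TensorSq.tmul B 1 r := rfl

@[simp] theorem coe_target (r : Subalgebra.centralizer K (B : Set A)) :
    ((unop (target B r) : BInv B) : TensorSq B) = TensorSq.tmul B r 1 := rfl

variable (B) in
/-- The source and target maps of `(A ⊗_B A)^B`. -/
def sourceTarget : SourceTarget K (Subalgebra.centralizer K (B : Set A)) (BInv B) where
  s := source B
  t := target B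
  comm := fun r r' => Subtype.ext (by simp [coe_mul])

/-- Since `x y` is `y¹ x y²`, right multiplication by source and target elements is the outer action
of `A` on `A ⊗_B A`. Thus compatibility with the `R'`-actions becomes `A`-linearity. -/
theorem coe_mul_source (x : BInv B) (r : Subalgebra.centralizer K (B : Set A)) :
    ((x * source B r : BInv B) : TensorSq B) = TensorSq.ractA B (op (r : A)) x := by
  simp [coe_mul]

theorem coe_mul_target (x : BInv B) (r : Subalgebra.centralizer K (B : Set A)) :
    ((x * unop (target B r) : BInv B) : TensorSq B) = TensorSq.lactA B (r : A) x := by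
  simp [coe_mul]

@[simp] theorem coe_ract (x : BInv B) (r : (Subalgebra.centralizer K (B : Set A))ᵐᵒᵖ) :
    (((sourceTarget B).ract r x : BInv B) : TensorSq B) =
      TensorSq.ractA B (op ((unop r : Subalgebra.centralizer K (B : Set A)) : A)) x :=
  coe_mul_source x (unop r)

@[simp] theorem coe_lact (x : BInv B) (r : Subalgebra.centralizer K (B : Set A)) :
    (((sourceTarget B).lact r x : BInv B) : TensorSq B) = TensorSq.lactA B (r : A) x :=
  coe_mul_target x r

variable (B) in
/-- The counit `x ↦ x¹ x²` of `(A ⊗_B A)^B`. -/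
def counit : BInv B →ₗ[K] Subalgebra.centralizer K (B : Set A) :=
  LinearMap.codRestrict (Subalgebra.toSubmodule (Subalgebra.centralizer K (B : Set A)))
    (TensorSq.mulMap B ∘ₗ (BInv B).subtype) mulMap_mem

@[simp] theorem coe_counit (x : BInv B) : (counit B x : A) = TensorSq.mulMap B x := rfl

theorem mapSnd_add (γ : A →ₗ[K] A) (hl : ∀ b ∈ B, ∀ a, γ (b * a) = b * γ a)
    (hr : ∀ b ∈ B, ∀ a, γ (a * b) = γ a * b) (x y : BInv B) :
    mapSnd γ hl hr (x + y) = mapSnd γ hl hr x + mapSnd γ hl hr y :=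
  Subtype.ext (map_add (TensorSq.mapSnd γ hl) (x : TensorSq B) y)

theorem mapSnd_smul (γ : A →ₗ[K] A) (hl : ∀ b ∈ B, ∀ a, γ (b * a) = b * γ a)
    (hr : ∀ b ∈ B, ∀ a, γ (a * b) = γ a * b) (k : K) (x : BInv B) :
    mapSnd γ hl hr (k • x) = k • mapSnd γ hl hr x :=
  Subtype.ext (map_smul (TensorSq.mapSnd γ hl) k (x : TensorSq B))

end BInv

/-! ### The dual basis given by quasibases, and coordinates. -/

namespace RightD2Quasibases

variable (q : RightD2Quasibases B)

/-- The linear map `t ↦ t¹ ⊗ γ j(t²)` on `(A ⊗_B A)^B`. -/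
def mapSnd (j : Fin q.m) : BInv B →ₗ[K] BInv B where
  toFun := BInv.mapSnd (q.γ j) (q.γ_left j) (q.γ_right j)
  map_add' := BInv.mapSnd_add _ _ _
  map_smul' := BInv.mapSnd_smul _ _ _

@[simp] theorem coe_mapSnd (j : Fin q.m) (x : BInv B) :
    (q.mapSnd j x : TensorSq B) = TensorSq.mapSnd (q.γ j) (q.γ_left j) x := rfl

/-- The coordinate `t ↦ t¹ γ j(t²)` of the dual basis of `(A ⊗_B A)^B` over the centralizer. -/
def coordFun (j : Fin q.m) : BInv B →ₗ[K] Subalgebra.centralizer K (B : Set A) :=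
  BInv.counit B ∘ₗ q.mapSnd j

theorem coe_coordFun (j : Fin q.m) (x : BInv B) :
    (q.coordFun j x : A) = TensorSq.contract (q.γ j) (q.γ_left j) x := rfl

theorem coordFun_lact (j : Fin q.m) (r : Subalgebra.centralizer K (B : Set A)) (x : BInv B) :
    q.coordFun j ((BInv.sourceTarget B).lact r x) = r * q.coordFun j x :=
  Subtype.ext (by simp [coe_coordFun, TensorSq.contract_lactA])

/-- On pure tensors this is the quasibasis equation. It needs no centrality of `z`; for central `z`
the coefficients lie in `R'`. -/
theorem sum_lactA (z : TensorSq B) :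
    ∑ j, TensorSq.lactA B (TensorSq.contract (q.γ j) (q.γ_left j) z) (q.u j : TensorSq B) = z := by
  induction z using TensorSq.induction_on with
  | tmul x y => simpa using (q.eq x y).symm
  | add z w hz hw => simp [Finset.sum_add_distrib, hz, hw]

theorem sum_lact (x : BInv B) :
    ∑ j, (BInv.sourceTarget B).lact (q.coordFun j x) (q.u j) = x :=
  Subtype.ext (by simpa [coe_coordFun] using q.sum_lactA x)

/-- Apply `F` to the quasibasis equation for `1 ⊗ a`. The identities between quasibases below are
instances of this one. -/
theorem sum_mul (F : TensorSq B →ₗ[K] A) (hF : ∀ a z, F (TensorSq.lactA B a z) = a * F z) (a : A) :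
    ∑ j, q.γ j a * F (q.u j) = F (TensorSq.tmul B 1 a) := by
  simp [q.eq 1 a, hF]

section Coord

variable {M : Type*} [AddCommGroup M] [Module K M]
  {ρ : (Subalgebra.centralizer K (B : Set A))ᵐᵒᵖ →ₐ[K] Module.End K M}

variable (ρ) in
/-- The `j`-th coordinate map `M ⊗ (A ⊗_B A)^B → M`. -/
def coord (j : Fin q.m) : BalTensor ρ (BInv.sourceTarget B).lact →ₗ[K] M :=
  BalTensor.lift
    (LinearMap.mk₂ K (fun m x => ρ (op (q.coordFun j x)) m)
      (by simp) (by simp) (by simp) (by simp))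
    (by intro r m x; simp [coordFun_lact])

@[simp] theorem coord_tmul (j : Fin q.m) (m : M) (x : BInv B) :
    q.coord ρ j (BalTensor.tmul _ _ m x) = ρ (op (q.coordFun j x)) m :=
  BalTensor.lift_tmul ..

/-- Expand `x` in the dual basis and move the coefficients across the tensor sign. -/
theorem sum_coord (z : BalTensor ρ (BInv.sourceTarget B).lact) :
    ∑ j, BalTensor.tmul _ _ (q.coord ρ j z) (q.u j) = z := by
  have : ∑ j, (BalTensor.tmulHom ρ (BInv.sourceTarget B).lact).flip (q.u j) ∘ₗ q.coord ρ j =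
      LinearMap.id := by
    apply BalTensor.hom_ext
    intro m x
    have h := congrArg (BalTensor.tmulHom ρ (BInv.sourceTarget B).lact m) (q.sum_lact x)
    rw [map_sum] at h
    simpa [BalTensor.tmul_act] using h
  simpa using LinearMap.congr_fun this z

theorem coord_ext {z w : BalTensor ρ (BInv.sourceTarget B).lact}
    (h : ∀ j, q.coord ρ j z = q.coord ρ j w) : z = w := by
  rw [← q.sum_coord z, ← q.sum_coord w]
  simp only [h]

end Coord

end RightD2Quasibases

end D2

section GaloisMap

variable {K R T A : Type*} [CommRing K] [Ring R] [Algebra K R] [Ring T] [Algebra K T]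
  [Ring A] [Algebra K A] {𝒯 : RightBialgebroid K R T} (𝒜 : ComoduleAlgebra 𝒯 A)

theorem ComoduleAlgebra.galoisMap_tmul (a a' : A) :
    𝒜.galoisMap (TensorSq.tmul 𝒜.coinv a a') = 𝒜.lactA a (𝒜.δ a') :=
  BalTensor.lift_tmul (ρ := mulRightAct 𝒜.coinv.val) (l := mulLeftAct 𝒜.coinv.val) _ _ a a'

end GaloisMap

/-! ### Identities between quasibases. -/

section D2

variable {K A : Type*} [CommRing K] [Ring A] [Algebra K A] {B : Subalgebra K A}

namespace RightD2Quasibases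

variable (q : RightD2Quasibases B)

theorem sum_mul_contract (k : Fin q.m) (a : A) :
    ∑ j, q.γ j a * TensorSq.contract (q.γ k) (q.γ_left k) (q.u j) = q.γ k a := by
  simpa using q.sum_mul _ (TensorSq.contract_lactA (q.γ k) (q.γ_left k)) a

theorem sum_mul_contract_mapSnd (k l : Fin q.m) (a : A) :
    ∑ j, q.γ j a * TensorSq.contract (q.γ l) (q.γ_left l)
      (TensorSq.mapSnd (q.γ k) (q.γ_left k) (q.u j)) = q.γ l (q.γ k a) := by
  simpa using q.sum_mul
    (TensorSq.contract (q.γ l) (q.γ_left l) ∘ₗ TensorSq.mapSnd (q.γ k) (q.γ_left k))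
    (fun a z => by simp [TensorSq.mapSnd_lactA, TensorSq.contract_lactA]) a

theorem sum_mul_contract_ractA (k : Fin q.m) (a r : A) :
    ∑ j, q.γ j a * TensorSq.contract (q.γ k) (q.γ_left k) (TensorSq.ractA B (op r) (q.u j)) =
      q.γ k (a * r) := by
  simpa using q.sum_mul
    (TensorSq.contract (q.γ k) (q.γ_left k) ∘ₗ TensorSq.ractA B (op r))
    (fun a z => by simp [← TensorSq.lactA_ractA, TensorSq.contract_lactA]) a

theorem sum_mul_mulMap (a : A) : ∑ j, q.γ j a * TensorSq.mulMap B (q.u j) = a := by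
  simpa using q.sum_mul _ TensorSq.mulMap_lactA a

theorem sum_mul_contract_sandwich (k : Fin q.m) (x : BInv B) (a : A) :
    ∑ j, q.γ j a * TensorSq.contract (q.γ k) (q.γ_left k) (BInv.sandwich x (q.u j)) =
      TensorSq.contract (q.γ k) (q.γ_left k) (TensorSq.ractA B (op a) x) := by
  simpa using q.sum_mul
    (TensorSq.contract (q.γ k) (q.γ_left k) ∘ₗ BInv.sandwich x)
    (fun a z => by simp [BInv.sandwich_lactA, TensorSq.contract_lactA]) a

/-- The source of multiplicativity of `Δ` and `δ`: the sum over `j` turns `u i * u j` into `u i`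
acted on by `a'` from the right, and the sum over `i` then yields `γ k(a a')`. -/
theorem sum_mul_mul_contract (k : Fin q.m) (a a' : A) :
    ∑ i, ∑ j, q.γ i a * q.γ j a' *
      TensorSq.contract (q.γ k) (q.γ_left k) ((q.u i * q.u j : BInv B) : TensorSq B) =
      q.γ k (a * a') := by
  simp only [mul_assoc, ← Finset.mul_sum, BInv.coe_mul, sum_mul_contract_sandwich,
    sum_mul_contract_ractA]

theorem sum_mul_contract_target (k : Fin q.m) (r : Subalgebra.centralizer K (B : Set A)) (a : A) :
    ∑ j, q.γ j a * TensorSq.contract (q.γ k) (q.γ_left k)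
      ((unop (BInv.target B r) * q.u j : BInv B) : TensorSq B) = r * q.γ k a := by
  simpa [BInv.coe_mul] using q.sum_mul_contract_sandwich k (unop (BInv.target B r)) a

/-- Transfers an identity `∑ γ j(y) c j = g(y)` in `A` to the second leg of a tensor; this is how
facts about `A` become facts about `T'`. -/
theorem sum_ractA_mapSnd (c : Fin q.m → A) (G : TensorSq B →ₗ[K] TensorSq B)
    (hG : ∀ x y, G (TensorSq.tmul B x y) = TensorSq.tmul B x (∑ j, q.γ j y * c j))
    (z : TensorSq B) :
    ∑ j, TensorSq.ractA B (op (c j)) (TensorSq.mapSnd (q.γ j) (q.γ_left j) z) = G z := by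
  induction z using TensorSq.induction_on with
  | tmul x y =>
    rw [hG]
    simp only [TensorSq.mapSnd_tmul, TensorSq.ractA_tmul, unop_op]
    exact TensorSq.sum_tmul ..
  | add z w hz hw => simp [Finset.sum_add_distrib, hz, hw]

/-! ### The coproduct, the coaction and their linearity. -/

/-- The coproduct `x ↦ ∑ j, (x¹ ⊗ γ j(x²)) ⊗ u j`. -/
def coproduct : BInv B →ₗ[K] (BInv.sourceTarget B).TT :=
  ∑ j, (BalTensor.tmulHom _ _).flip (q.u j) ∘ₗ q.mapSnd j

theorem coproduct_apply (x : BInv B) :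
    q.coproduct x = ∑ j, BalTensor.tmul _ _ (q.mapSnd j x) (q.u j) := by
  simp [coproduct]

/-- The `u j` need not be a basis, so coefficients of a sum are not automatically its coordinates.
Here they are, because `∑ γ j(y) · (u j)¹ γ k((u j)²) = γ k(y)`. -/
theorem coord_coproduct (k : Fin q.m) (x : BInv B) :
    q.coord _ k (q.coproduct x) = q.mapSnd k x := by
  apply Subtype.ext
  rw [coproduct_apply]
  simp [coe_coordFun]
  apply q.sum_ractA_mapSnd
  simp [sum_mul_contract]

variable (B) in
/-- The inclusion of the centralizer. -/
abbrev incl : Subalgebra.centralizer K (B : Set A) →ₐ[K] A :=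
  (Subalgebra.centralizer K (B : Set A)).val

/-- The coaction `a ↦ ∑ j, γ j(a) ⊗ u j`. -/
def coaction : A →ₗ[K] (BInv.sourceTarget B).AT (incl B) :=
  ∑ j, (BalTensor.tmulHom _ _).flip (q.u j) ∘ₗ q.γ j

theorem coaction_apply (a : A) :
    q.coaction a = ∑ j, BalTensor.tmul _ _ (q.γ j a) (q.u j) := by
  simp [coaction]

theorem coord_coaction (k : Fin q.m) (a : A) :
    q.coord _ k (q.coaction a) = q.γ k a := by
  rw [coaction_apply]
  simpa [coe_coordFun] using q.sum_mul_contract k a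

theorem coord_actSnd_ract {M : Type*} [AddCommGroup M] [Module K M]
    {ρ : (Subalgebra.centralizer K (B : Set A))ᵐᵒᵖ →ₐ[K] Module.End K M} (k : Fin q.m) (m : M)
    (r : Subalgebra.centralizer K (B : Set A)) (x : BInv B)
    (h) : q.coord ρ k (BalTensor.actSnd (BInv.sourceTarget B).ract h (op r)
      (BalTensor.tmul _ _ m x)) =
      ρ (op (q.coordFun k ((BInv.sourceTarget B).ract (op r) x))) m := by
  rw [BalTensor.actSnd_tmul, coord_tmul]

theorem coproduct_lact (r : Subalgebra.centralizer K (B : Set A)) (x : BInv B) :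
    q.coproduct ((BInv.sourceTarget B).lact r x) =
      (BInv.sourceTarget B).lactTT r (q.coproduct x) := by
  rw [coproduct_apply, coproduct_apply, map_sum]
  refine Finset.sum_congr rfl fun j _ => ?_
  rw [BalTensor.actFst_tmul]
  congr 1
  exact Subtype.ext (by simp [TensorSq.mapSnd_lactA])

/-- Unlike the left action, this one falls on the factors `u j`, so the two sides do not agree term
by term and are compared in coordinates. -/
theorem coproduct_ract (r : Subalgebra.centralizer K (B : Set A)) (x : BInv B) :
    q.coproduct ((BInv.sourceTarget B).ract (op r) x) =
      (BInv.sourceTarget B).ractTT (op r) (q.coproduct x) := by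
  refine q.coord_ext fun k => ?_
  rw [coord_coproduct, coproduct_apply, map_sum, map_sum]
  simp only [coord_actSnd_ract]
  apply Subtype.ext
  simp [coe_coordFun]
  rw [q.sum_ractA_mapSnd _ (TensorSq.mapSnd (q.γ k) (q.γ_left k) ∘ₗ TensorSq.ractA B (op (r : A)))]
  · rfl
  · simp [sum_mul_contract_ractA]

theorem coaction_ract (r : Subalgebra.centralizer K (B : Set A)) (a : A) :
    q.coaction (mulRightAct (incl B) (op r) a) =
      (BInv.sourceTarget B).ractAT (incl B) (op r) (q.coaction a) := by
  refine q.coord_ext fun k => ?_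
  rw [coord_coaction, coaction_apply, map_sum, map_sum]
  simp only [coord_actSnd_ract]
  simp [coe_coordFun, sum_mul_contract_ractA]


/-! ### Coassociativity. -/

/-- The first coordinates of `(D ⊗ id) z`. -/
theorem coord_map {M M' : Type*} [AddCommGroup M] [Module K M] [AddCommGroup M'] [Module K M']
    {ρ : (Subalgebra.centralizer K (B : Set A))ᵐᵒᵖ →ₐ[K] Module.End K M}
    {ρ' : (Subalgebra.centralizer K (B : Set A))ᵐᵒᵖ →ₐ[K] Module.End K M'}
    (D : M →ₗ[K] M') (hD : ∀ r m, D (ρ (op r) m) = ρ' (op r) (D m)) (k : Fin q.m)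
    (z : BalTensor ρ (BInv.sourceTarget B).lact) :
    q.coord ρ' k (BalTensor.map D LinearMap.id hD (BalTensor.id_lact _) z) =
      D (q.coord ρ k z) := by
  induction z using BalTensor.induction_on with
  | tmul m n => rw [BalTensor.map_tmul, coord_tmul, coord_tmul, hD]; rfl
  | add z w hz hw => simp only [map_add, hz, hw]

theorem coord_assocInv {M : Type*} [AddCommGroup M] [Module K M]
    (ρ : (Subalgebra.centralizer K (B : Set A))ᵐᵒᵖ →ₐ[K] Module.End K M) (k : Fin q.m)
    (m : M) (w : (BInv.sourceTarget B).TT) :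
    q.coord _ k (BalTensor.assocInv ρ _ _ _ (BInv.sourceTarget B).act_comm
      (BalTensor.tmul _ _ m w)) =
      BalTensor.tmul ρ (BInv.sourceTarget B).lact m (q.coord _ k w) := by
  induction w using BalTensor.induction_on with
  | tmul x y => rw [BalTensor.assocInv_tmul, coord_tmul, coord_tmul, BalTensor.actSnd_tmul]
  | add z w hz hw => simp only [map_add, BalTensor.tmul_add, hz, hw]

theorem coord_coassoc_term {M : Type*} [AddCommGroup M] [Module K M]
    (ρ : (Subalgebra.centralizer K (B : Set A))ᵐᵒᵖ →ₐ[K] Module.End K M) (k l : Fin q.m)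
    (m : M) (x : BInv B) :
    q.coord ρ l (q.coord _ k (BalTensor.assocInv ρ _ _ _ (BInv.sourceTarget B).act_comm
        (BalTensor.map (ρ := ρ) (l := (BInv.sourceTarget B).lact)
          (ρ' := ρ) (l' := (BInv.sourceTarget B).lactTT)
          LinearMap.id q.coproduct (BalTensor.id_ract _) q.coproduct_lact
          (BalTensor.tmul _ _ m x)))) = ρ (op (q.coordFun l (q.mapSnd k x))) m := by
  rw [BalTensor.map_tmul, coord_assocInv, coord_coproduct, coord_tmul, LinearMap.id_apply]

theorem coord_coassoc_sum {M : Type*} [AddCommGroup M] [Module K M]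
    (ρ : (Subalgebra.centralizer K (B : Set A))ᵐᵒᵖ →ₐ[K] Module.End K M) (k l : Fin q.m)
    {ι : Type*} (s : Finset ι) (m : ι → M) (x : ι → BInv B) :
    q.coord ρ l (q.coord _ k (BalTensor.assocInv ρ _ _ _ (BInv.sourceTarget B).act_comm
        (BalTensor.map (ρ := ρ) (l := (BInv.sourceTarget B).lact)
          (ρ' := ρ) (l' := (BInv.sourceTarget B).lactTT)
          LinearMap.id q.coproduct (BalTensor.id_ract _) q.coproduct_lact
          (∑ j ∈ s, BalTensor.tmul _ _ (m j) (x j))))) =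
      ∑ j ∈ s, ρ (op (q.coordFun l (q.mapSnd k (x j)))) (m j) := by
  induction s using Finset.cons_induction with
  | empty => simp only [Finset.sum_empty, map_zero]
  | cons a s ha ih => simp only [Finset.sum_cons, map_add, coord_coassoc_term, ih]

/-- Treats `Δ` and `δ` together. Taking coordinates in the last factor and then in the middle one
reduces coassociativity to an identity in `M`, which is `H`. -/
theorem map_eq_assocInv_map {M : Type*} [AddCommGroup M] [Module K M]
    (ρ : (Subalgebra.centralizer K (B : Set A))ᵐᵒᵖ →ₐ[K] Module.End K M)
    (D : M →ₗ[K] BalTensor ρ (BInv.sourceTarget B).lact)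
    (hD : ∀ r m, D (ρ (op r) m) = BalTensor.actSnd (ρ := ρ) (BInv.sourceTarget B).ract
      (fun r' r x => ((BInv.sourceTarget B).act_comm r r' x).symm) (op r) (D m))
    (H : ∀ k l m, ∑ j, ρ (op (q.coordFun l (q.mapSnd k (q.u j)))) (q.coord ρ j (D m)) =
      q.coord ρ l (D (q.coord ρ k (D m)))) (m : M) :
    BalTensor.map (ρ := ρ) (l := (BInv.sourceTarget B).lact)
        (ρ' := BalTensor.actSnd (ρ := ρ) (BInv.sourceTarget B).ract
          (fun r' r x => ((BInv.sourceTarget B).act_comm r r' x).symm))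
        (l' := (BInv.sourceTarget B).lact) D LinearMap.id hD (BalTensor.id_lact _) (D m) =
      BalTensor.assocInv _ _ _ _ (BInv.sourceTarget B).act_comm
        (BalTensor.map (ρ := ρ) (l := (BInv.sourceTarget B).lact)
          (ρ' := ρ) (l' := (BInv.sourceTarget B).lactTT)
          LinearMap.id q.coproduct (BalTensor.id_ract _) q.coproduct_lact (D m)) := by
  refine q.coord_ext fun k => ?_
  rw [coord_map]
  refine q.coord_ext fun l => ?_
  have h := q.coord_coassoc_sum ρ k l Finset.univ (fun j => q.coord ρ j (D m)) q.u
  rw [sum_coord] at h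
  exact (H k l m).symm.trans h.symm

/-- Both sides have iterated coordinates `x¹ ⊗ γ l(γ k(x²))`. -/
theorem coproduct_coassoc (x : BInv B) :
    BalTensor.map (ρ := (BInv.sourceTarget B).ract) (l := (BInv.sourceTarget B).lact)
        (ρ' := (BInv.sourceTarget B).ractTT) (l' := (BInv.sourceTarget B).lact)
        q.coproduct LinearMap.id q.coproduct_ract (BalTensor.id_lact _) (q.coproduct x) =
      BalTensor.assocInv _ _ _ _ (BInv.sourceTarget B).act_comm
        (BalTensor.map (ρ := (BInv.sourceTarget B).ract) (l := (BInv.sourceTarget B).lact)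
          (ρ' := (BInv.sourceTarget B).ract) (l' := (BInv.sourceTarget B).lactTT)
          LinearMap.id q.coproduct (BalTensor.id_ract _) q.coproduct_lact (q.coproduct x)) := by
  refine q.map_eq_assocInv_map (BInv.sourceTarget B).ract q.coproduct q.coproduct_ract
    (fun k l m => ?_) x
  simp only [coord_coproduct]
  apply Subtype.ext
  simp only [coe_mapSnd, AddSubmonoidClass.coe_finsetSum, BInv.coe_ract, unop_op, coe_coordFun]
  rw [q.sum_ractA_mapSnd _ (TensorSq.mapSnd (q.γ l) (q.γ_left l) ∘ₗ
    TensorSq.mapSnd (q.γ k) (q.γ_left k))]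
  · rfl
  · simp [sum_mul_contract_mapSnd]

theorem coaction_coassoc (x : A) :
    BalTensor.map (ρ := mulRightAct (incl B)) (l := (BInv.sourceTarget B).lact)
        (ρ' := (BInv.sourceTarget B).ractAT (incl B)) (l' := (BInv.sourceTarget B).lact)
        q.coaction LinearMap.id q.coaction_ract (BalTensor.id_lact _) (q.coaction x) =
      BalTensor.assocInv _ _ _ _ (BInv.sourceTarget B).act_comm
        (BalTensor.map (ρ := mulRightAct (incl B)) (l := (BInv.sourceTarget B).lact)
          (ρ' := mulRightAct (incl B)) (l' := (BInv.sourceTarget B).lactTT)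
          LinearMap.id q.coproduct (BalTensor.id_ract _) q.coproduct_lact (q.coaction x)) := by
  refine q.map_eq_assocInv_map (mulRightAct (incl B)) q.coaction q.coaction_ract
    (fun k l m => ?_) x
  simp [coord_coaction, coe_coordFun, sum_mul_contract_mapSnd]

/-! ### The Takeuchi condition, multiplicativity and units. -/

theorem coproduct_takeuchi (r : Subalgebra.centralizer K (B : Set A)) (x : BInv B)
    (z : BInv B ⊗[K] BInv B) (hz : BalTensor.mk _ _ z = q.coproduct x) :
    BalTensor.mk (BInv.sourceTarget B).ract (BInv.sourceTarget B).lact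
        ((BInv.source B r ⊗ₜ[K] 1) * z) =
      BalTensor.mk (BInv.sourceTarget B).ract (BInv.sourceTarget B).lact
        ((1 ⊗ₜ[K] unop (BInv.target B r)) * z) := by
  have hz' : BalTensor.mk (BInv.sourceTarget B).ract (BInv.sourceTarget B).lact z =
      BalTensor.mk (BInv.sourceTarget B).ract (BInv.sourceTarget B).lact
        (∑ j, q.mapSnd j x ⊗ₜ[K] q.u j) := by
    rw [hz, coproduct_apply, map_sum]; rfl
  have h : ∀ v, BalTensor.mk (BInv.sourceTarget B).ract (BInv.sourceTarget B).lact (v * z) =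
      BalTensor.mk (BInv.sourceTarget B).ract (BInv.sourceTarget B).lact
        (v * ∑ j, q.mapSnd j x ⊗ₜ[K] q.u j) := fun v =>
    SourceTarget.mk_mul_left_congr (BInv.sourceTarget B) (BInv.source B) v hz'
  rw [h, h]
  -- Both sides have coordinates `x¹ ⊗ r γ k(x²)`.
  refine q.coord_ext fun k => Subtype.ext ?_
  simp only [Finset.mul_sum, map_sum, Algebra.TensorProduct.tmul_mul_tmul, one_mul,
    BalTensor.mk_tmul, coord_tmul, unop_op, AddSubmonoidClass.coe_finsetSum,
    BInv.coe_ract, coe_coordFun, BInv.coe_mul, coe_mapSnd]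
  -- A central element need not be a sum of central pure tensors, so the induction runs over all of
  -- `A ⊗_B A`.
  generalize (x : TensorSq B) = v
  induction v using TensorSq.induction_on with
  | tmul a b =>
    have h := q.sum_mul_contract_target k r b
    simp only [BInv.coe_mul] at h
    simp [TensorSq.sum_tmul, mul_assoc, ← Finset.mul_sum, sum_mul_contract, h]
  | add v w hv hw => simp only [map_add, Finset.sum_add_distrib, hv, hw]

theorem coaction_takeuchi (r : Subalgebra.centralizer K (B : Set A)) (a : A)
    (z : A ⊗[K] BInv B) (hz : BalTensor.mk _ _ z = q.coaction a) :
    BalTensor.mk (mulRightAct (incl B)) (BInv.sourceTarget B).lact (((r : A) ⊗ₜ[K] 1) * z) =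
      BalTensor.mk (mulRightAct (incl B)) (BInv.sourceTarget B).lact
        ((1 ⊗ₜ[K] unop (BInv.target B r)) * z) := by
  have hz' : BalTensor.mk (mulRightAct (incl B)) (BInv.sourceTarget B).lact z =
      BalTensor.mk (mulRightAct (incl B)) (BInv.sourceTarget B).lact
        (∑ j, q.γ j a ⊗ₜ[K] q.u j) := by
    rw [hz, coaction_apply, map_sum]; rfl
  rw [SourceTarget.mk_mul_left_congr _ _ _ hz', SourceTarget.mk_mul_left_congr _ _ _ hz']
  refine q.coord_ext fun k => ?_
  simp only [Finset.mul_sum, map_sum, Algebra.TensorProduct.tmul_mul_tmul, one_mul,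
    BalTensor.mk_tmul, coord_tmul]
  simp [coe_coordFun, sum_mul_contract_target, mul_assoc, sum_mul_contract, ← Finset.mul_sum]

theorem coproduct_mul (x y : BInv B) (z w : BInv B ⊗[K] BInv B)
    (hz : BalTensor.mk _ _ z = q.coproduct x) (hw : BalTensor.mk _ _ w = q.coproduct y) :
    q.coproduct (x * y) = BalTensor.mk _ _ (z * w) := by
  have hz' : BalTensor.mk (BInv.sourceTarget B).ract (BInv.sourceTarget B).lact z =
      BalTensor.mk (BInv.sourceTarget B).ract (BInv.sourceTarget B).lact
        (∑ j, q.mapSnd j x ⊗ₜ[K] q.u j) := by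
    rw [hz, coproduct_apply, map_sum]; rfl
  have hw' : BalTensor.mk (BInv.sourceTarget B).ract (BInv.sourceTarget B).lact w =
      BalTensor.mk (BInv.sourceTarget B).ract (BInv.sourceTarget B).lact
        (∑ j, q.mapSnd j y ⊗ₜ[K] q.u j) := by
    rw [hw, coproduct_apply, map_sum]; rfl
  -- Changing the left factor needs the Takeuchi condition for the right one; changing the right
  -- factor is unconditional.
  have h1 : BalTensor.mk (BInv.sourceTarget B).ract (BInv.sourceTarget B).lact (z * w) =
      BalTensor.mk (BInv.sourceTarget B).ract (BInv.sourceTarget B).lact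
        ((∑ j, q.mapSnd j x ⊗ₜ[K] q.u j) * w) :=
    SourceTarget.mk_mul_right_congr (BInv.sourceTarget B) (BInv.source B) w
      (fun r => q.coproduct_takeuchi r y w hw) hz'
  have h2 : BalTensor.mk (BInv.sourceTarget B).ract (BInv.sourceTarget B).lact ((∑ j, q.mapSnd j x ⊗ₜ[K] q.u j) * w) =
      BalTensor.mk (BInv.sourceTarget B).ract (BInv.sourceTarget B).lact
        ((∑ j, q.mapSnd j x ⊗ₜ[K] q.u j) * ∑ j, q.mapSnd j y ⊗ₜ[K] q.u j) :=
    SourceTarget.mk_mul_left_congr (BInv.sourceTarget B) (BInv.source B) _ hw'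
  rw [h1, h2]
  refine q.coord_ext fun k => Subtype.ext ?_
  rw [coord_coproduct]
  simp only [Finset.sum_mul_sum, map_sum, Algebra.TensorProduct.tmul_mul_tmul, BalTensor.mk_tmul,
    coord_tmul, unop_op, AddSubmonoidClass.coe_finsetSum, BInv.coe_ract, coe_coordFun,
    BInv.coe_mul, coe_mapSnd]
  generalize (y : TensorSq B) = v
  induction v using TensorSq.induction_on with
  | tmul a b =>
    simp only [BInv.sandwich_tmul, TensorSq.mapSnd_tmul, coe_mapSnd]
    generalize (x : TensorSq B) = w
    induction w using TensorSq.induction_on with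
    | tmul c d =>
      have h := q.sum_mul_mul_contract k d b
      simp only [BInv.coe_mul] at h
      simp [TensorSq.sum_tmul, h]
    | add v w hv hw => simp [Finset.sum_add_distrib, hv, hw]
  | add v w hv hw => simp [Finset.sum_add_distrib, hv, hw]

theorem coaction_mul (x y : A) (z w : A ⊗[K] BInv B)
    (hz : BalTensor.mk _ _ z = q.coaction x) (hw : BalTensor.mk _ _ w = q.coaction y) :
    q.coaction (x * y) = BalTensor.mk _ _ (z * w) := by
  have hz' : BalTensor.mk (mulRightAct (incl B)) (BInv.sourceTarget B).lact z =
      BalTensor.mk (mulRightAct (incl B)) (BInv.sourceTarget B).lact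
        (∑ j, q.γ j x ⊗ₜ[K] q.u j) := by
    rw [hz, coaction_apply, map_sum]; rfl
  have hw' : BalTensor.mk (mulRightAct (incl B)) (BInv.sourceTarget B).lact w =
      BalTensor.mk (mulRightAct (incl B)) (BInv.sourceTarget B).lact
        (∑ j, q.γ j y ⊗ₜ[K] q.u j) := by
    rw [hw, coaction_apply, map_sum]; rfl
  rw [SourceTarget.mk_mul_right_congr _ _ w (fun r => q.coaction_takeuchi r y w hw) hz',
    SourceTarget.mk_mul_left_congr _ _ _ hw']
  refine q.coord_ext fun k => ?_
  rw [coord_coaction, ← sum_mul_mul_contract]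
  simp [Finset.sum_mul_sum, BalTensor.mk_tmul, coe_coordFun]

theorem coproduct_one : q.coproduct 1 = BalTensor.tmul _ _ 1 1 := by
  refine q.coord_ext fun k => Subtype.ext ?_
  rw [coord_coproduct, coord_tmul]
  simp [BInv.coe_one, coe_coordFun]

theorem coaction_one : q.coaction 1 = BalTensor.tmul _ _ 1 1 := by
  refine q.coord_ext fun k => ?_
  rw [coord_coaction, coord_tmul]
  simp [BInv.coe_one, coe_coordFun]

/-! ### The bialgebroid and the comodule algebra. -/

/-- The right bialgebroid `(A ⊗_B A)^B` over the centralizer of `B`. -/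
def bialgebroid :
    RightBialgebroid K (Subalgebra.centralizer K (B : Set A)) (BInv B) where
  toSourceTarget := BInv.sourceTarget B
  Δ := q.coproduct
  ε := BInv.counit B
  Δ_left := q.coproduct_lact
  Δ_right := q.coproduct_ract
  ε_left := fun r x => Subtype.ext (by simp [TensorSq.mulMap_lactA])
  ε_right := fun r x => Subtype.ext (by simp [TensorSq.mulMap_ractA])
  coassoc := q.coproduct_coassoc
  counit_left := fun x => by
    rw [coproduct_apply, map_sum]
    refine Eq.trans (Finset.sum_congr rfl fun j _ => BalTensor.lift_tmul _ _ _ _) ?_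
    -- The coefficient `ε(x¹ ⊗ γ j(x²))` is the `j`-th dual basis coordinate of `x`.
    exact q.sum_lact x
  counit_right := fun x => by
    rw [coproduct_apply, map_sum]
    refine Eq.trans (Finset.sum_congr rfl fun j _ => BalTensor.lift_tmul _ _ _ _) ?_
    refine Subtype.ext ?_
    rw [AddSubmonoidClass.coe_finsetSum]
    refine Eq.trans (Finset.sum_congr rfl fun j _ => BInv.coe_mul_source _ _) ?_
    refine q.sum_ractA_mapSnd _ LinearMap.id (fun a b => ?_) _
    exact congrArg (TensorSq.tmul B a) (q.sum_mul_mulMap b).symm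
  Δ_one := q.coproduct_one
  ε_one := Subtype.ext (by simp [BInv.coe_one])
  -- Here and in `ε_mul_s` both sides equal `y¹ ε(x) y²`.
  ε_mul_t := fun x y => Subtype.ext (by
    simp only [BInv.coe_counit, BInv.coe_mul]
    generalize (y : TensorSq B) = v
    change _ = TensorSq.mulMap B (BInv.sandwich (unop (BInv.target B (BInv.counit B x))) v)
    induction v using TensorSq.induction_on with
    | tmul a b => simp [TensorSq.mulMap_lactA, TensorSq.mulMap_ractA, mul_assoc]
    | add v w hv hw => simp [hv, hw])
  ε_mul_s := fun x y => Subtype.ext (by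
    simp only [BInv.coe_counit, BInv.coe_mul]
    generalize (y : TensorSq B) = v
    change _ = TensorSq.mulMap B (BInv.sandwich (BInv.source B (BInv.counit B x)) v)
    induction v using TensorSq.induction_on with
    | tmul a b => simp [TensorSq.mulMap_lactA, TensorSq.mulMap_ractA]
    | add v w hv hw => simp [hv, hw])
  Δ_takeuchi := q.coproduct_takeuchi
  Δ_mul := q.coproduct_mul

theorem isCanonicalBialgebroid : IsCanonicalBialgebroid q q.bialgebroid where
  s_eq _ := rfl
  t_eq _ := rfl
  ε_eq _ := rfl
  Δ_eq := q.coproduct_apply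

/-- `A` as a right `(A ⊗_B A)^B`-comodule algebra. -/
def comoduleAlgebra : ComoduleAlgebra q.bialgebroid A where
  η := incl B
  δ := q.coaction
  δ_right := q.coaction_ract
  coassoc := q.coaction_coassoc
  counit := fun a => by
    refine (congrArg _ (q.coaction_apply a)).trans ((map_sum _ _ _).trans ?_)
    refine Eq.trans (Finset.sum_congr rfl fun j _ => BalTensor.lift_tmul _ _ _ _) ?_
    exact q.sum_mul_mulMap a
  δ_one := q.coaction_one
  δ_takeuchi := q.coaction_takeuchi
  δ_mul := q.coaction_mul

theorem isCanonicalCoaction : IsCanonicalCoaction q q.comoduleAlgebra where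
  η_eq _ := rfl
  δ_eq := q.coaction_apply

/-! ### The Galois map of the new extension, and its coinvariants. -/

/-- The map `x ⊗ y ↦ ∑ j, x γ j(y) ⊗ u j` from `A ⊗_B A` to `A ⊗ (A ⊗_B A)^B`. -/
def galois : TensorSq B →ₗ[K] (BInv.sourceTarget B).AT (incl B) :=
  ∑ j, (BalTensor.tmulHom _ _).flip (q.u j) ∘ₗ TensorSq.contract (q.γ j) (q.γ_left j)

theorem galois_apply (z : TensorSq B) :
    q.galois z =
      ∑ j, BalTensor.tmul _ _ (TensorSq.contract (q.γ j) (q.γ_left j) z) (q.u j) := by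
  simp [galois]

theorem coord_galois (k : Fin q.m) (z : TensorSq B) :
    q.coord _ k (q.galois z) = TensorSq.contract (q.γ k) (q.γ_left k) z := by
  conv_rhs => rw [← q.sum_lactA z]
  simp [galois_apply, coe_coordFun, TensorSq.contract_lactA]

/-- The coordinates of the image are the coefficients that rebuild `z` in `sum_lactA`. -/
theorem galois_injective : Function.Injective q.galois := by
  intro z w h
  rw [← q.sum_lactA z, ← q.sum_lactA w]
  simp only [← coord_galois, h]

theorem galois_surjective : Function.Surjective q.galois := by
  rw [← LinearMap.range_eq_top, eq_top_iff]
  rintro z -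
  induction z using BalTensor.induction_on with
  | tmul a t =>
    refine ⟨TensorSq.lactA B a t, q.coord_ext fun k => ?_⟩
    rw [coord_galois, coord_tmul, TensorSq.contract_lactA]
    rfl
  | add z w hz hw => exact add_mem hz hw

theorem galois_one_tmul (a : A) : q.galois (TensorSq.tmul B 1 a) = q.coaction a :=
  q.coord_ext fun k => by rw [coord_galois, coord_coaction]; simp

theorem galois_tmul_one (a : A) : q.galois (TensorSq.tmul B a 1) = BalTensor.tmul _ _ a 1 :=
  q.coord_ext fun k => by rw [coord_galois, coord_tmul]; simp [coe_coordFun, BInv.coe_one]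

theorem galois_lactA (a : A) (z : TensorSq B) :
    q.galois (TensorSq.lactA B a z) =
      BalTensor.actFst (mulLeftAct (AlgHom.id K A)) (mulLeftAct_comm (incl B)) a (q.galois z) := by
  rw [galois_apply, galois_apply, map_sum]
  refine Finset.sum_congr rfl fun j _ => ?_
  rw [BalTensor.actFst_tmul, TensorSq.contract_lactA]
  rfl

/-- The Galois map sends `1 ⊗ a` to `δ a` and `a ⊗ 1` to `a ⊗ 1`, and it is injective. -/
theorem mem_coinv_comoduleAlgebra (a : A) :
    a ∈ q.comoduleAlgebra.coinv ↔ TensorSq.tmul B 1 a = TensorSq.tmul B a 1 := by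
  rw [← q.galois_injective.eq_iff, galois_one_tmul, galois_tmul_one]
  rfl

/-- The Galois map lives on the tensor square over the coinvariants, which equal `B` only by a
theorem; a variable `C` allows substitution. -/
theorem bijective_of_tmul {C : Subalgebra K A} (h : C = B)
    (G : TensorSq C →ₗ[K] (BInv.sourceTarget B).AT (incl B))
    (hG : ∀ x y, G (TensorSq.tmul C x y) = q.galois (TensorSq.tmul B x y)) :
    Function.Bijective G := by
  subst h
  have e : G = q.galois := BalTensor.hom_ext hG
  rw [e]
  exact ⟨q.galois_injective, q.galois_surjective⟩

theorem bijective_galoisMap_comoduleAlgebra (h : q.comoduleAlgebra.coinv = B) :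
    Function.Bijective q.comoduleAlgebra.galoisMap := by
  refine q.bijective_of_tmul h q.comoduleAlgebra.galoisMap fun x y => ?_
  have e : TensorSq.tmul B x y = TensorSq.lactA B x (TensorSq.tmul B 1 y) := by simp
  rw [e, galois_lactA, galois_one_tmul]
  exact q.comoduleAlgebra.galoisMap_tmul x y

end RightD2Quasibases

end D2

/-! ### A dual basis of `T` over `R`. -/

namespace RightBialgebroid

variable {K R T : Type*} [CommRing K] [Ring R] [Algebra K R] [Ring T] [Algebra K T]
  {𝒯 : RightBialgebroid K R T}

theorem LeftFiniteProjective.exists_dualBasis (h : 𝒯.LeftFiniteProjective) :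
    ∃ (n : ℕ) (x : Fin n → T) (f : Fin n → T →ₗ[K] R),
      (∀ i r z, f i (𝒯.lact r z) = r * f i z) ∧ ∀ z, ∑ i, 𝒯.lact (f i z) (x i) = z := by
  let := 𝒯.leftModule
  have : Module.Finite R T := h.1
  have : Module.Projective R T := h.2
  obtain ⟨n, p, g, -, -, hpg⟩ := Module.Finite.exists_comp_eq_id_of_projective R T
  have hact : ∀ (r : R) (z : T), r • z = 𝒯.lact r z := fun _ _ => rfl
  refine ⟨n, fun i => p (Pi.single i 1), fun i =>
    { toFun := fun z => g z i
      map_add' := fun z w => by simp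
      map_smul' := fun k z => ?_ }, fun i r z => ?_, fun z => ?_⟩
  -- Coordinates are `R`-linear; `K`-linearity follows because `K` acts on `T` through `R`.
  · have e : k • z = algebraMap K R k • z := by
      rw [hact, AlgHom.commutes]; rfl
    rw [e, map_smul]
    simp [Algebra.smul_def]
  · change g (𝒯.lact r z) i = r * g z i
    rw [← hact, map_smul]
    rfl
  · have h1 : p (g z) = z := LinearMap.congr_fun hpg z
    conv_rhs => rw [← h1, pi_eq_sum_univ' (g z), map_sum]
    refine Finset.sum_congr rfl fun i _ => ?_
    rw [map_smul]
    rfl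

end RightBialgebroid

/-! ### Quasibases from a split Galois map. -/

namespace ComoduleAlgebra

variable {K R T A : Type*} [CommRing K] [Ring R] [Algebra K R] [Ring T] [Algebra K T]
  [Ring A] [Algebra K A] {𝒯 : RightBialgebroid K R T} (𝒜 : ComoduleAlgebra 𝒯 A)

/-- `a ⊗ x ↦ a * η (f x)` for a left `R`-linear `f : T → R`. -/
def evalSnd (f : T →ₗ[K] R) (hf : ∀ r z, f (𝒯.lact r z) = r * f z) : 𝒯.AT 𝒜.η →ₗ[K] A :=
  BalTensor.lift ((LinearMap.mul K A).compl₂ (𝒜.η.toLinearMap ∘ₗ f))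
    (fun r m n => by simp [hf, mul_assoc])

theorem evalSnd_tmul (f : T →ₗ[K] R) (hf : ∀ r z, f (𝒯.lact r z) = r * f z) (a : A) (x : T) :
    𝒜.evalSnd f hf (𝒜.tmul a x) = a * 𝒜.η (f x) :=
  BalTensor.lift_tmul _ _ a x

/-- For `δ b = b ⊗ 1` the Takeuchi condition reads `η r b ⊗ 1 = b ⊗ t r`. Apply `id ⊗ ε` and use
`ε(t r) = r`. -/
theorem coinv_comm (b : A) (hb : b ∈ 𝒜.coinv) (r : R) : b * 𝒜.η r = 𝒜.η r * b := by
  have h := 𝒜.δ_takeuchi r b (b ⊗ₜ[K] 1) hb.symm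
  rw [Algebra.TensorProduct.tmul_mul_tmul, Algebra.TensorProduct.tmul_mul_tmul] at h
  have h' := congrArg (𝒜.evalSnd 𝒯.ε 𝒯.ε_left) h
  have e := 𝒯.ε_left r 1
  simp only [SourceTarget.lact, antiMulAct_apply, one_mul, 𝒯.ε_one, mul_one] at e
  refine Eq.trans ?_ (h'.symm.trans ?_)
  · refine ((𝒜.evalSnd_tmul 𝒯.ε 𝒯.ε_left _ _).trans ?_).symm
    simp [e]
  · refine (𝒜.evalSnd_tmul 𝒯.ε 𝒯.ε_left _ _).trans ?_
    simp [𝒯.ε_one]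

theorem evalSnd_lactA (f : T →ₗ[K] R) (hf : ∀ r z, f (𝒯.lact r z) = r * f z) (a : A)
    (z : 𝒯.AT 𝒜.η) : 𝒜.evalSnd f hf (𝒜.lactA a z) = a * 𝒜.evalSnd f hf z := by
  induction z using BalTensor.induction_on with
  | tmul m n =>
    have e : 𝒜.lactA a (BalTensor.tmul _ _ m n) = 𝒜.tmul (a * m) n :=
      BalTensor.actFst_tmul _ (mulLeftAct_comm 𝒜.η) a m n
    rw [e, evalSnd_tmul]
    refine Eq.trans ?_ (congrArg _ (𝒜.evalSnd_tmul f hf m n).symm)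
    rw [mul_assoc]
  | add z w hz hw => simp only [map_add, hz, hw, mul_add]

/-- Here `δ(a b) = a₀ b ⊗ a₁`, and `b` moves past `η (f a₁)` by `coinv_comm`. -/
theorem evalSnd_δ_mul_coinv (f : T →ₗ[K] R) (hf : ∀ r z, f (𝒯.lact r z) = r * f z) (a b : A)
    (hb : b ∈ 𝒜.coinv) : 𝒜.evalSnd f hf (𝒜.δ (a * b)) = 𝒜.evalSnd f hf (𝒜.δ a) * b := by
  obtain ⟨w, hw⟩ := BalTensor.mk_surjective (𝒜.δ a)
  rw [𝒜.δ_mul a b w (b ⊗ₜ[K] 1) hw hb.symm, ← hw]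
  clear hw
  induction w using TensorProduct.induction_on with
  | zero => simp
  | add x y hx hy => simp only [add_mul, map_add, hx, hy]
  | tmul x y =>
    rw [Algebra.TensorProduct.tmul_mul_tmul, mul_one]
    refine (𝒜.evalSnd_tmul f hf _ _).trans ?_
    refine Eq.trans ?_ (congrArg (· * b) (𝒜.evalSnd_tmul f hf x y).symm)
    simp only [mul_assoc, 𝒜.coinv_comm b hb]

/-- A comodule algebra over a left finite projective bialgebroid with split monic Galois map has
right depth two quasibases over its coinvariants. -/
theorem GaloisMapSplitMonic.nonempty_quasibases (h𝒯 : 𝒯.LeftFiniteProjective)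
    (h : 𝒜.GaloisMapSplitMonic) : Nonempty (RightD2Quasibases 𝒜.coinv) := by
  obtain ⟨n, x, f, hf, hx⟩ := h𝒯.exists_dualBasis
  obtain ⟨σ, hσl, hσr, hσ⟩ := h
  have hexp : ∀ z : 𝒯.AT 𝒜.η, z = ∑ i, 𝒜.tmul (𝒜.evalSnd (f i) (hf i) z) (x i) := by
    intro z
    induction z using BalTensor.induction_on with
    | tmul a t =>
      have e := congrArg (BalTensor.tmulHom (mulRightAct 𝒜.η) 𝒯.lact a) (hx t)
      rw [map_sum] at e
      refine e.symm.trans (Finset.sum_congr rfl fun i _ => ?_)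
      refine (BalTensor.tmul_act (ρ := mulRightAct 𝒜.η) (l := 𝒯.lact) (f i t) a (x i)).symm.trans ?_
      exact congrArg (𝒜.tmul · (x i)) (𝒜.evalSnd_tmul (f i) (hf i) a t).symm
    | add z w hz hw =>
      conv_lhs => rw [hz, hw]
      simp [tmul, Finset.sum_add_distrib]
  refine ⟨{
    m := n
    u := fun i => ⟨σ (𝒜.tmul 1 (x i)), fun b hb => ?_⟩
    γ := fun i => 𝒜.evalSnd (f i) (hf i) ∘ₗ 𝒜.δ
    γ_left := fun i b hb a => ?_
    γ_right := fun i b hb a => 𝒜.evalSnd_δ_mul_coinv (f i) (hf i) a b hb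
    eq := fun a a' => ?_ }⟩
  -- Centrality of `u i`: both `b (1 ⊗ x i)` and `(1 ⊗ x i) b` are `b ⊗ x i`, and `σ` is a bimodule
  -- map.
  · rw [← hσl, ← hσr _ _ b hb, mul_one, one_mul]
  · simp only [LinearMap.comp_apply]
    rw [𝒜.δ_coinv_mul b hb, evalSnd_lactA]
  -- Write `a ⊗ a'` as `σ(β(a ⊗ a'))` and expand the inner value in the dual basis.
  · rw [← hσ (TensorSq.tmul 𝒜.coinv a a'), hexp (𝒜.galoisMap _), map_sum]
    refine Finset.sum_congr rfl fun i _ => ?_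
    rw [galoisMap_tmul, evalSnd_lactA, ← hσl, mul_one]
    rfl

/-- The original Galois map takes `1 ⊗ a = a ⊗ 1` to `δ a = a ⊗ 1`; conversely a coinvariant moves
across the tensor sign. -/
theorem coinv_comoduleAlgebra (q : RightD2Quasibases 𝒜.coinv) :
    q.comoduleAlgebra.coinv = 𝒜.coinv := by
  ext a
  rw [q.mem_coinv_comoduleAlgebra]
  constructor
  · intro h
    have e := congrArg 𝒜.galoisMap h
    rw [galoisMap_tmul, galoisMap_tmul, 𝒜.δ_one, map_one] at e
    refine e.trans ((BalTensor.actFst_tmul (l := 𝒯.lact) _ (mulLeftAct_comm 𝒜.η) a 1 1).trans ?_)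
    simp [tmul]
  · intro h
    simpa using (TensorSq.tmul_mul (B := 𝒜.coinv) ⟨a, h⟩ 1 1).symm

end ComoduleAlgebra
end

theorem corollary2p2 {K R T A : Type*} [CommRing K] [Ring R] [Algebra K R] [Ring T] [Algebra K T]
    [Ring A] [Algebra K A] (𝒯 : RightBialgebroid K R T) (h𝒯 : 𝒯.LeftFiniteProjective)
    (𝒜 : ComoduleAlgebra 𝒯 A) (hβ : 𝒜.GaloisMapSplitMonic) :
    ∃ (q : RightD2Quasibases 𝒜.coinv)
      (𝒯' : RightBialgebroid K (Subalgebra.centralizer K (𝒜.coinv : Set A)) (BInv 𝒜.coinv))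
      (𝒜' : ComoduleAlgebra 𝒯' A),
      IsCanonicalBialgebroid q 𝒯' ∧ IsCanonicalCoaction q 𝒜' ∧ 𝒜'.IsGaloisOver 𝒜.coinv := by
  obtain ⟨q⟩ := ComoduleAlgebra.GaloisMapSplitMonic.nonempty_quasibases 𝒜 h𝒯 hβ
  have h := 𝒜.coinv_comoduleAlgebra q
  exact ⟨q, q.bialgebroid, q.comoduleAlgebra, q.isCanonicalBialgebroid, q.isCanonicalCoaction,
    h, q.bijective_galoisMap_comoduleAlgebra h⟩
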